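/- Let $N\ge 2$, and let $\kappa=(-1)^{N/2+1}$ if $N$ is even and $\kappa\in\{1,-1\}$ if $N$ is odd. Let $I\subset\mathbb{R}$ be open, let $u_0,\dots,u_{N-2}\colon I\to\mathbb{C}$ be smooth, and let $\mathcal{L}=\partial_x^N+u_{N-2}(x)\partial_x^{N-2}+\cdots+u_0(x)$. Let $A_N(z)=\frac{1}{2\pi i}\int_{c-i\infty}^{c+i\infty}e^{z\xi+\kappa\xi^N}\,d\xi$, where $c=0$ if $N$ is even, and, if $N$ is odd, $c>0$ when $\kappa=(-1)^{(N+1)/2}$ and $c<0$ when $\kappa=(-1)^{(N-1)/2}$. Let $H_k^j(x,y)$ ($k\ge1$, $0\le j\le N-2$) be the Hadamard coefficients of $\partial_t v=\kappa\mathcal{L}v$: smooth functions on an open neighborhood $U\subset I\times I$ of the diagonal of $I$ such that, for fixed $y$, the formal series $$\mathcal{H}(x,y,t)=t^{-1/N}A_N\!\left(\tfrac{x-y}{t^{1/N}}\right)+\sum_{j=0}^{N-2}t^{-(j+1)/N}A_N^{(j)}\!\left(\tfrac{x-y}{t^{1/N}}\right)\sum_{k=1}^{\infty}H_k^j(x,y)t^k\qquad(t>0)$$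 is a solution of $\partial_t v=\kappa\mathcal{L}v$, in the sense that for every $M\ge 0$ the truncation $\mathcal{H}_M$ of the series after the terms with $t^M$ satisfies $(\partial_t-\kappa\mathcal{L})\mathcal{H}_M=t^M\sum_{j=0}^{N-2}r_{j}(x,y)\,t^{-(j+1)/N}A_N^{(j)}\big(\tfrac{x-y}{t^{1/N}}\big)$ for some functions $r_j$ that do not depend on $t$. In the ring of formal pseudo-differential operators $\sum_{i\le m}r_i(x)\partial_x^i$, with product given by $\partial_x^k\cdot r=\sum_{i\ge0}\binom{k}{i}r^{(i)}\partial_x^{k-i}$ ($k\in\mathbb{Z}$), let $S=1+\sum_{k\ge1}\psi_k(x)\partial_x^{-k}$ be an operator with smooth coefficients on $I$ such that $\mathcal{L}=S\partial_x^NS^{-1}$. Let $S^*$ be its formal adjoint (determined by $\partial_x^*=-\partial_x$), let $\Psi(x,z)=Se^{xz}$ and $\Psi^*(x,z)=(S^*)^{-1}e^{-xz}$, where $\partial_x^je^{\pm xz}=(\pm z)^je^{\pm xz}$ for all $j\in\mathbb{Z}$, and define $\omega_n(x,y)$ by $$\Psi(x,z)\Psi^*(y,z)=\Big(\sum_{n=0}^{\infty}\omega_n(x,y)z^{-n}\Big)e^{(x-y)z}.$$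 Let $D_N=-\partial_x^{-N+1}(x-y)$, where $y$ is treated as a parameter independent of $x$, and let $$H(x,y,\partial_x)=1+\sum_{j=0}^{N-2}\sum_{k=1}^{\infty}H_k^j(x,y)\frac{\kappa^k}{N^k}\,\partial_x^jD_N^k .$$ Then, when $H(x,y,\partial_x)$ is expanded in powers of $\partial_x$ with the coefficients on the left, $$H(x,y,\partial_x)=\sum_{n=0}^{\infty}\omega_n(x,y)\,\partial_x^{-n}$$ near the diagonal, namely at all points $(x,y)$ such that $(s,y)\in U$ for every $s$ between $x$ and $y$. -/

import Mathlib

open scoped ContDiff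

/-- A formal pseudo-differential operator `∑_{i ≤ m} r_i(x) ∂_x^i` in one real variable:
the family of its coefficients, with only finitely many positive powers of `∂_x`.
(`r_i` is only meaningful on the open set where the operator is considered.) -/
@[ext]
structure FPDO where
  coeff : ℤ → ℝ → ℂ
  bdd : ∃ m : ℤ, ∀ i : ℤ, m < i → coeff i = 0

namespace FPDO

/-- The operator has order at most `m`. -/
def OrderLE (P : FPDO) (m : ℤ) : Prop := ∀ i : ℤ, m < i → P.coeff i = 0

/-- The coefficients of a product. By the generalized Leibniz rule
`∂^i · b = ∑_l (i choose l) b^{(l)} ∂^{i-l}`, the coefficient of `∂^p` in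
`(∑ a_i ∂^i)(∑ b_n ∂^n)` is the sum of `(i choose l) a_i b_n^{(l)}` over `i - l + n = p`
(a finite sum). -/
noncomputable def mulCoeff (a b : ℤ → ℝ → ℂ) (p : ℤ) (x : ℝ) : ℂ :=
  ∑ᶠ q : ℤ × ℕ, ((Ring.choose q.1 q.2 : ℤ) : ℂ) * a q.1 x *
    iteratedDeriv q.2 (b (p - q.1 + q.2)) x

theorem mulCoeff_eq_zero {a b : ℤ → ℝ → ℂ} {m n : ℤ} (ha : ∀ i, m < i → a i = 0)
    (hb : ∀ i, n < i → b i = 0) : ∀ p, m + n < p → mulCoeff a b p = 0 := by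
  intro p hp
  funext x
  unfold mulCoeff
  refine finsum_eq_zero_of_forall_eq_zero fun q => ?_
  by_cases h : m < q.1
  · simp [ha _ h]
  · have h0 : b (p - q.1 + q.2) = 0 := hb _ (by omega)
    rw [h0]
    simp

noncomputable instance : Mul FPDO where
  mul P Q :=
    { coeff := mulCoeff P.coeff Q.coeff
      bdd := by
        obtain ⟨m, hm⟩ := P.bdd
        obtain ⟨n, hn⟩ := Q.bdd
        exact ⟨m + n, mulCoeff_eq_zero hm hn⟩ }

instance : Neg FPDO where
  neg P :=
    { coeff := fun i x => -P.coeff i x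
      bdd := by
        obtain ⟨m, hm⟩ := P.bdd
        exact ⟨m, fun i hi => by funext x; simp [hm i hi]⟩ }

/-- The operator `∂_x^m`, `m ∈ ℤ`. -/
def del (m : ℤ) : FPDO where
  coeff i _ := if i = m then 1 else 0
  bdd := ⟨m, fun i hi => by funext x; simp [hi.ne']⟩

/-- The operator of multiplication by a function. -/
def ofFun (f : ℝ → ℂ) : FPDO where
  coeff i x := if i = 0 then f x else 0
  bdd := ⟨0, fun i hi => by funext x; simp [hi.ne']⟩

instance : One FPDO := ⟨ofFun 1⟩

noncomputable instance : Pow FPDO ℕ := ⟨fun P k => npowRec k P⟩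

/-- The formal adjoint: `(∑ a_i ∂^i)^* = ∑ (-∂)^i · a_i`, so that the coefficient of `∂^p` is
the (finite) sum over `l ≥ 0` of `(-1)^{p+l} (p+l choose l) a_{p+l}^{(l)}`. -/
noncomputable def adjoint (P : FPDO) : FPDO where
  coeff p x := ∑ᶠ l : ℕ, (-1 : ℂ) ^ (p + l) * ((Ring.choose (p + l) l : ℤ) : ℂ) *
    iteratedDeriv l (P.coeff (p + l)) x
  bdd := by
    obtain ⟨m, hm⟩ := P.bdd
    refine ⟨m, fun i hi => ?_⟩
    funext x
    refine finsum_eq_zero_of_forall_eq_zero fun l => ?_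
    have h0 : P.coeff (i + l) = 0 := hm _ (by omega)
    rw [h0]
    simp

/-- Equality of two operators on a set of the variable `x`. -/
def EqOn (P Q : FPDO) (I : Set ℝ) : Prop := ∀ i : ℤ, ∀ x ∈ I, P.coeff i x = Q.coeff i x

/-- All the coefficients are smooth on `I`. -/
def SmoothOn (P : FPDO) (I : Set ℝ) : Prop := ∀ i : ℤ, ContDiffOn ℝ ∞ (P.coeff i) I

/-- `Q` is the inverse of `P` in the formal pseudo-differential operators on `I`. -/
def IsInverseOn (P Q : FPDO) (I : Set ℝ) : Prop :=
  Q.SmoothOn I ∧ (P * Q).EqOn 1 I ∧ (Q * P).EqOn 1 I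

theorem OrderLE.mul {P Q : FPDO} {m n : ℤ} (hP : P.OrderLE m) (hQ : Q.OrderLE n) :
    (P * Q).OrderLE (m + n) :=
  mulCoeff_eq_zero hP hQ

theorem orderLE_del (m : ℤ) : (del m).OrderLE m := fun i hi => by
  funext x; simp [del, hi.ne']

theorem orderLE_ofFun (f : ℝ → ℂ) : (ofFun f).OrderLE 0 := fun i hi => by
  funext x; simp [ofFun, hi.ne']

theorem OrderLE.neg {P : FPDO} {m : ℤ} (hP : P.OrderLE m) : (-P).OrderLE m := fun i hi => by
  funext x
  change -P.coeff i x = 0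
  simp [hP i hi]

theorem OrderLE.pow {P : FPDO} {m : ℤ} (hP : P.OrderLE m) (k : ℕ) :
    (P ^ k).OrderLE (k * m) := by
  induction k with
  | zero =>
    have h : (P ^ 0).OrderLE 0 := orderLE_ofFun 1
    simpa using h
  | succ k ih =>
    have h : (P ^ k * P).OrderLE (k * m + m) := ih.mul hP
    have e : ((k + 1 : ℕ) : ℤ) * m = k * m + m := by push_cast; ring
    rw [e]
    exact h

end FPDO

/-- The admissible signs `κ_N`: `(-1)^{N/2+1}` for even `N`, and `±1` for odd `N`. -/
def IsHeatSign (N : ℕ) (κ : ℝ) : Prop :=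
  (Even N → κ = (-1) ^ (N / 2 + 1)) ∧ (Odd N → κ = 1 ∨ κ = -1)

/-- A real part `c` of the line of integration `c + iℝ` for which the Airy-type integral converges
absolutely: `c = 0` if `N` is even; if `N` is odd, `c > 0` for `κ = (-1)^{(N+1)/2}` and `c < 0` for
`κ = (-1)^{(N-1)/2}`. -/
noncomputable def airyAbscissa (N : ℕ) (κ : ℝ) : ℝ :=
  if Even N then 0 else -κ * (-1) ^ ((N - 1) / 2)

/-- The Airy-type function
`A_N(z; κ) = (2πi)⁻¹ ∫_{c-i∞}^{c+i∞} exp(zξ + κ ξ^N) dξ`, with `ξ = c + is`. -/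
noncomputable def airyFun (N : ℕ) (κ : ℝ) (z : ℝ) : ℂ :=
  (1 / (2 * Real.pi) : ℂ) * ∫ s : ℝ,
    Complex.exp (z * (airyAbscissa N κ + Complex.I * s) +
      κ * (airyAbscissa N κ + Complex.I * s) ^ N)

/-- The function `t^{-(j+1)/N} A_N^{(j)}((x-y)/t^{1/N})`, for `t > 0`. -/
noncomputable def airyTerm (N : ℕ) (κ : ℝ) (j : ℕ) (x y t : ℝ) : ℂ :=
  ((t ^ (-((j : ℝ) + 1) / N) : ℝ) : ℂ) *
    iteratedDeriv j (airyFun N κ) ((x - y) / t ^ ((1 : ℝ) / N))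

/-- The action on functions of `ℒ = ∂^N + u_{N-2} ∂^{N-2} + ⋯ + u_0`. -/
noncomputable def applyL (N : ℕ) (u : ℕ → ℝ → ℂ) (f : ℝ → ℂ) (x : ℝ) : ℂ :=
  iteratedDeriv N f x + ∑ i ∈ Finset.range (N - 1), u i x * iteratedDeriv i f x

/-- The heat kernel expansion with coefficients `H k j = H_k^j`, truncated after the power `t^M`:
`t^{-1/N} A_N(⋅) + ∑_{j=0}^{N-2} t^{-(j+1)/N} A_N^{(j)}(⋅) ∑_{k=1}^M H_k^j(x,y) t^k`. -/
noncomputable def heatKernelTrunc (N : ℕ) (κ : ℝ) (H : ℕ → ℕ → ℝ → ℝ → ℂ) (M : ℕ)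
    (x y t : ℝ) : ℂ :=
  airyTerm N κ 0 x y t + ∑ j ∈ Finset.range (N - 1),
    airyTerm N κ j x y t * ∑ k ∈ Finset.Icc 1 M, H k j x y * (t : ℂ) ^ k

/-- The formal expansion with coefficients `H k j = H_k^j` solves `∂_t v = κ ℒ v` over `U`, for each
fixed `y`. The series in `t` is formal, so this means that all the coefficients of
`t^k · t^{-(j+1)/N} A_N^{(j)}((x-y)/t^{1/N})`, `j = 0, …, N-2`, in `(∂_t - κ ℒ) v` vanish: for
every `M`, the truncation after `t^M` leaves a remainder with terms `k = M` only. -/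
def IsFormalHeatSolution (N : ℕ) (κ : ℝ) (u : ℕ → ℝ → ℂ) (U : Set (ℝ × ℝ))
    (H : ℕ → ℕ → ℝ → ℝ → ℂ) : Prop :=
  ∀ M : ℕ, ∀ x y : ℝ, (x, y) ∈ U → ∃ r : ℕ → ℂ, ∀ t : ℝ, 0 < t →
    deriv (fun τ => heatKernelTrunc N κ H M x y τ) t
        - κ * applyL N u (fun ξ => heatKernelTrunc N κ H M ξ y t) x
      = ∑ j ∈ Finset.range (N - 1), r j * ((t : ℂ) ^ M * airyTerm N κ j x y t)

/-- `H k j = H_k^j` (`k ≥ 1`, `0 ≤ j ≤ N-2`) are the Hadamard coefficients of `∂_t v = κ ℒ v` over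
the neighbourhood `U` of the diagonal of `I`. -/
structure IsHadamard (N : ℕ) (κ : ℝ) (u : ℕ → ℝ → ℂ) (I : Set ℝ) (U : Set (ℝ × ℝ))
    (H : ℕ → ℕ → ℝ → ℝ → ℂ) : Prop where
  isOpen : IsOpen U
  subset : U ⊆ I ×ˢ I
  diag : ∀ x ∈ I, (x, x) ∈ U
  smooth : ∀ k j : ℕ, 1 ≤ k → j < N - 1 → ContDiffOn ℝ ∞ (fun p : ℝ × ℝ => H k j p.1 p.2) U
  heat : IsFormalHeatSolution N κ u U H

/-- `ℒ = ∂^N + u_{N-2} ∂^{N-2} + ⋯ + u_0` as a formal pseudo-differential operator. -/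
def opL (N : ℕ) (u : ℕ → ℝ → ℂ) : FPDO where
  coeff i x := if i = N then 1 else if 0 ≤ i ∧ i < (N : ℤ) - 1 then u i.toNat x else 0
  bdd := ⟨N, fun i hi => by
    funext x
    rw [if_neg (by omega), if_neg (by omega)]
    rfl⟩

/-- `S = 1 + ∑_{k ≥ 1} ψ_k(x) ∂^{-k}` is a wave operator of `ℒ` on `I`: `ℒ = S ∂^N S⁻¹`. -/
structure IsWaveOperator (N : ℕ) (u : ℕ → ℝ → ℂ) (I : Set ℝ) (S : FPDO) : Prop where
  smooth : S.SmoothOn I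
  order : ∀ i : ℤ, 0 < i → ∀ x ∈ I, S.coeff i x = 0
  monic : ∀ x ∈ I, S.coeff 0 x = 1
  dressing : ∃ R : FPDO, S.IsInverseOn R I ∧ (opL N u).EqOn (S * FPDO.del N * R) I

/-- The factor `∑_k ψ_k(x) z^{-k}` of `Ψ(x,z) = S e^{xz}`, as a power series in `z⁻¹`
(`∂_x^j e^{xz} = z^j e^{xz}`). -/
def waveSeries (S : FPDO) (x : ℝ) : PowerSeries ℂ :=
  PowerSeries.mk fun k => S.coeff (-(k : ℤ)) x

/-- The factor `∑_k ψ*_k(x) z^{-k}` of `Ψ*(x,z) = T e^{-xz}`, where `T = (S*)⁻¹`, as a power series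
in `z⁻¹` (`∂_x^j e^{-xz} = (-z)^j e^{-xz}`). -/
def adjointWaveSeries (T : FPDO) (x : ℝ) : PowerSeries ℂ :=
  PowerSeries.mk fun k => (-1) ^ k * T.coeff (-(k : ℤ)) x

/-- `ω_n(x,y)`: the coefficient of `z^{-n}` in `Ψ(x,z) Ψ*(y,z) e^{-(x-y)z}`. -/
noncomputable def resolventCoeff (S T : FPDO) (n : ℕ) (x y : ℝ) : ℂ :=
  PowerSeries.coeff n (waveSeries S x * adjointWaveSeries T y)

/-- `w n = ω_n` are the coefficients of the resolvent `Ψ(x,z) Ψ*(y,z)` of `ℒ` on `I`, computed from some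
wave operator `S` of `ℒ` and `T = (S*)⁻¹`. -/
def IsResolventCoeff (N : ℕ) (u : ℕ → ℝ → ℂ) (I : Set ℝ) (w : ℕ → ℝ → ℝ → ℂ) : Prop :=
  ∃ S T : FPDO, IsWaveOperator N u I S ∧ S.adjoint.IsInverseOn T I ∧
    ∀ n : ℕ, ∀ x ∈ I, ∀ y ∈ I, w n x y = resolventCoeff S T n x y

/-- `D_N = -∂_x^{-N+1} (x - y)`, with `y` a parameter. -/
noncomputable def opD (N : ℕ) (y : ℝ) : FPDO :=
  -(FPDO.del (1 - (N : ℤ)) * FPDO.ofFun fun x => ((x - y : ℝ) : ℂ))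

theorem orderLE_opD (N : ℕ) (y : ℝ) : (opD N y).OrderLE (1 - (N : ℤ)) := by
  have h := ((FPDO.orderLE_del (1 - (N : ℤ))).mul
    (FPDO.orderLE_ofFun fun x => ((x - y : ℝ) : ℂ))).neg
  rw [add_zero] at h
  exact h

/-- `H(x,y,∂_x) = 1 + ∑_{j=0}^{N-2} ∑_{k ≥ 1} H_k^j(x,y) (κ/N)^k ∂_x^j D_N^k`, expanded in powers of
`∂_x` with coefficients on the left (`y` is a parameter). As `∂_x^j D_N^k` has order
`j - k(N-1)`, only finitely many `k` contribute to the coefficient of each `∂_x^p`. -/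
noncomputable def heatOp (N : ℕ) (κ : ℝ) (H : ℕ → ℕ → ℝ → ℝ → ℂ) (y : ℝ) : FPDO where
  coeff p x := (1 : FPDO).coeff p x + ∑ j ∈ Finset.range (N - 1), ∑ᶠ k : ℕ,
    if 1 ≤ k then
      H k j x y * ((κ : ℂ) / N) ^ k * (FPDO.del j * opD N y ^ k).coeff p x
    else 0
  bdd := by
    refine ⟨0, fun p hp => ?_⟩
    funext x
    have h1 : (1 : FPDO).coeff p = 0 := FPDO.orderLE_ofFun 1 p hp
    rw [h1]
    simp only [Pi.zero_apply, zero_add]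
    refine Finset.sum_eq_zero fun j hj => finsum_eq_zero_of_forall_eq_zero fun k => ?_
    split_ifs with hk
    · have hj' := Finset.mem_range.1 hj
      have h2 : (FPDO.del j * opD N y ^ k).coeff p = 0 := by
        refine ((FPDO.orderLE_del (j : ℤ)).mul ((orderLE_opD N y).pow k)) p ?_
        have hN : (1 : ℤ) - N ≤ 0 := by omega
        have hk' : (1 : ℤ) ≤ k := by exact_mod_cast hk
        have : (k : ℤ) * (1 - N) ≤ 1 * (1 - N) := mul_le_mul_of_nonpos_right hk' hN
        omega
      rw [h2]
      simp
    · rfl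

/-- The operator `∑_{n ≥ 0} ω_n(x,y) ∂_x^{-n}`, with `y` a parameter. -/
def resolventOp (w : ℕ → ℝ → ℝ → ℂ) (y : ℝ) : FPDO where
  coeff p x := if p ≤ 0 then w (-p).toNat x y else 0
  bdd := ⟨0, fun p hp => by funext x; simp [hp]⟩

/-! Fix `y` and regard both sides as operators `E` in `x`. Each has three properties: (a) `E` is `1`
plus terms of negative order; (b) `ℒ E = E ∂^N`; (c) for every `a ≥ 0` the coefficient of `∂^{-1}`
in `∂^a E` vanishes at `x = y`. These determine `E` (`symbol_eq_zero`): a difference of two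
solutions has negative order; if its coefficients above `∂^{-n-1}` vanish, (b) says that the
coefficient of `∂^{-n-1}` has zero derivative and (c) with `a = n` that it is zero at `y`, so it is
zero at every point joined to `y` inside the domain.

For the resolvent, `∑ ω_n ∂^{-n} = ∑_b ψ*_b(y) S ∂^{-b}`. So (b) is `ℒ S = S ∂^N`
(`applyLSym_wave`), and (c) says that `(S*)⁻¹ S* = 1` has no term in `∂^{-a-1}`
(`sum_adjointInverse_delMul`).

For the heat operator, (c) holds because `D_N` ends in the factor `x - y` (`symPow_residue`). For
(b), let `t^k · t^{-(j+1)/N} A^{(j)}` correspond to `(κ/N)^k ∂^j D_N^k`. Since `[∂^N, D_N] = -N`,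
the operator `∂_t` corresponds to right multiplication by `κ ∂^N`; since `∂^{N-1} D_N = -(x - y)`,
the Airy equation holds on both sides. Hence reducing `(∂_t - κℒ)` of a truncation to `j ≤ N-2`
gives the same coefficients for functions and for operators (`heatTerm_mem_span`). Off the diagonal
the functions are linearly independent (`airyTerm_linearIndependent`), so the heat equation kills
all coefficients with `k < M`; those with `k = M` multiply operators of too low an order to matter.
This gives `ℒ H = H ∂^N` for `x ≠ y`, and continuity extends it to the diagonal. -/

namespace HeatResolvent

/-! ### The Airy-type function: convergence, differential equation, non-vanishing. -/

section AiryFunction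

open MeasureTheory Complex

theorem isHeatSign_sq_eq_one {N : ℕ} {κ : ℝ} (h : IsHeatSign N κ) : κ ^ 2 = 1 := by
  rcases Nat.even_or_odd N with he | ho
  · rw [h.1 he, ← pow_mul, mul_comm, pow_mul]; simp
  · rcases h.2 ho with h | h <;> simp [h]

/-- The point `c + is` of the line of integration. -/
noncomputable def airyPt (N : ℕ) (κ s : ℝ) : ℂ := airyAbscissa N κ + I * s

theorem exists_bound_sub_pow (d : ℕ) (hd : 1 ≤ d) {D R : ℝ} (hD : 0 ≤ D) (hR : 0 ≤ R) :
    ∃ C : ℝ, ∀ a : ℝ, 0 ≤ a → D * (1 + a) ^ d - a ^ (d + 1) + R * a ≤ C := by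
  -- Beyond `B` one has `(1 + a)^d ≤ 2^d a^d` and `a ≤ a^d`, so `a^(d+1)` dominates; below `B`
  -- monotonicity suffices.
  set B : ℝ := 2 ^ d * D + R + 1 with hB
  have hB0 : 0 ≤ B := by positivity
  refine ⟨D * (1 + B) ^ d + R * B, fun a ha => ?_⟩
  by_cases hab : a ≤ B
  · have h1 : (1 + a) ^ d ≤ (1 + B) ^ d := by gcongr
    have h2 : 0 ≤ a ^ (d + 1) := by positivity
    have h3 : D * (1 + a) ^ d ≤ D * (1 + B) ^ d := by gcongr
    have h4 : R * a ≤ R * B := by gcongr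
    linarith
  · push Not at hab
    have h0 : (0 : ℝ) ≤ 2 ^ d * D := by positivity
    have ha1 : 1 ≤ a := by linarith
    have h1 : (1 + a) ^ d ≤ 2 ^ d * a ^ d := by
      rw [← mul_pow]; gcongr; linarith
    have h2 : a ≤ a ^ d := le_self_pow₀ ha1 (by omega)
    have h3 : D * (1 + a) ^ d ≤ D * (2 ^ d * a ^ d) := by gcongr
    have h4 : R * a ≤ R * a ^ d := by gcongr
    have h5 : 0 ≤ a ^ d * (a - (2 ^ d * D + R)) := by
      apply mul_nonneg (by positivity); linarith
    have h6 : 0 ≤ D * (1 + B) ^ d + R * B := by positivity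
    rw [pow_succ]
    nlinarith

theorem norm_airyAbscissa_odd {N : ℕ} {κ : ℝ} (hκ : IsHeatSign N κ) (ho : ¬ Even N) :
    |airyAbscissa N κ| = 1 := by
  have h : |κ| = 1 := by
    rcases hκ.2 (Nat.not_even_iff_odd.1 ho) with h | h <;> simp [h]
  simp [airyAbscissa, ho, abs_mul, h]

/-- For even `N` the sign `κ` makes the phase equal to `-|s|^N`. For odd `N` the top term is purely
imaginary, the sign of `c` makes the next one `-N |s|^(N-1)`, and the rest is `O((1 + |s|)^(N-2))`.
-/
theorem re_phase_le {N : ℕ} (hN : 2 ≤ N) {κ : ℝ} (hκ : IsHeatSign N κ) :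
    ∃ d : ℕ, 1 ≤ d ∧ ∃ D : ℝ, 0 ≤ D ∧ ∀ s : ℝ,
      (κ * airyPt N κ s ^ N).re ≤ D * (1 + |s|) ^ d - |s| ^ (d + 1) := by
  by_cases he : Even N
  · refine ⟨N - 1, by omega, 0, le_rfl, fun s => ?_⟩
    obtain ⟨m, hm⟩ := he
    have hκ' := hκ.1 ⟨m, hm⟩
    have hm2 : N / 2 = m := by omega
    rw [hm2] at hκ'
    have h1 : airyPt N κ s ^ N = (((-1) ^ m * s ^ N : ℝ) : ℂ) := by
      have : airyAbscissa N κ = 0 := by simp [airyAbscissa, show Even N from ⟨m, hm⟩]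
      rw [airyPt, this, ofReal_zero, zero_add, mul_pow]
      have : (I : ℂ) ^ N = (-1) ^ m := by rw [hm, ← two_mul, pow_mul, I_sq]
      rw [this]; push_cast; ring
    rw [h1, ← ofReal_mul, ofReal_re, hκ', Nat.sub_add_cancel (by omega)]
    have h2 : |s| ^ N = s ^ N := Even.pow_abs ⟨m, hm⟩ s
    have h3 : ((-1 : ℝ) ^ m) * (-1) ^ m = 1 := by rw [← pow_add, ← two_mul, pow_mul]; simp
    rw [h2, pow_succ]
    have : (-1 : ℝ) ^ m * -1 * ((-1) ^ m * s ^ N) = -(((-1 : ℝ) ^ m) * (-1) ^ m) * s ^ N := by ring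
    rw [this, h3]; simp
  · have ho := Nat.not_even_iff_odd.1 he
    obtain ⟨q, hq⟩ := ho
    have hq1 : 1 ≤ q := by omega
    refine ⟨N - 2, by omega, 2 ^ N, by positivity, fun s => ?_⟩
    have hc1 := norm_airyAbscissa_odd hκ he
    have hc : airyAbscissa N κ = -κ * (-1) ^ q := by
      simp only [airyAbscissa, he, if_false]
      congr 2; omega
    set c := airyAbscissa N κ with hcdef
    have hκ2 := isHeatSign_sq_eq_one hκ
    have hexp : airyPt N κ s ^ N = (I * s) ^ N + (I * s) ^ (N - 1) * c * N +
        ∑ m ∈ Finset.range (N - 1), (I * s) ^ m * (c : ℂ) ^ (N - m) * (N.choose m : ℂ) := by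
      rw [airyPt, ← hcdef, add_comm, add_pow]
      conv_lhs => rw [show N + 1 = (N - 1) + 1 + 1 by omega]
      rw [Finset.sum_range_succ, Finset.sum_range_succ]
      have e1 : N - 1 + 1 = N := by omega
      have e2 : N - (N - 1) = 1 := by omega
      have e3 : N.choose (N - 1) = N := by
        rw [Nat.choose_symm_of_eq_add (show N = (N - 1) + 1 by omega), Nat.choose_one_right]
      rw [e1, e2, e3]; simp; ring
    have hI : (I : ℂ) ^ (2 * q) = (-1) ^ q := by rw [pow_mul, I_sq]
    have hA : (κ * (I * s) ^ N : ℂ).re = 0 := by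
      have : (κ * (I * s) ^ N : ℂ) = ((κ * (-1) ^ q * s ^ N : ℝ) : ℂ) * I := by
        rw [mul_pow]; nth_rw 1 [hq]; rw [pow_succ, hI]; push_cast; ring
      rw [this, re_ofReal_mul, I_re, mul_zero]
    have hB : (κ * ((I * s) ^ (N - 1) * c * N) : ℂ) = ((-(N : ℝ) * |s| ^ (N - 1) : ℝ) : ℂ) := by
      have h2 : |s| ^ (N - 1) = s ^ (N - 1) := Even.pow_abs ⟨q, by omega⟩ s
      have h3 : N - 1 = 2 * q := by omega
      rw [h2, mul_pow]; nth_rw 1 [h3]; rw [hI, hc]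
      have h4 : ((-1 : ℂ) ^ q) * (-1) ^ q = 1 := by rw [← pow_add, ← two_mul, pow_mul]; simp
      have h5 : (κ : ℂ) ^ 2 = 1 := by exact_mod_cast hκ2
      push_cast
      linear_combination (-(s : ℂ) ^ (N - 1) * N) * ((κ : ℂ) ^ 2) * h4 +
        (-(s : ℂ) ^ (N - 1) * N) * h5
    have hC : ‖∑ m ∈ Finset.range (N - 1), (I * s) ^ m * (c : ℂ) ^ (N - m) * (N.choose m : ℂ)‖ ≤
        2 ^ N * (1 + |s|) ^ (N - 2) := by
      refine (norm_sum_le _ _).trans ?_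
      calc _ ≤ ∑ m ∈ Finset.range (N - 1), (1 + |s|) ^ (N - 2) * (N.choose m : ℝ) := by
            refine Finset.sum_le_sum fun m hm => ?_
            have hm' := Finset.mem_range.1 hm
            simp only [norm_mul, norm_pow, norm_I, one_mul, norm_real, Real.norm_eq_abs, hc1,
              one_pow, mul_one, Complex.norm_natCast]
            gcongr
            calc |s| ^ m ≤ (1 + |s|) ^ m := by gcongr; linarith
              _ ≤ (1 + |s|) ^ (N - 2) :=
                pow_le_pow_right₀ (by linarith [abs_nonneg s]) (by omega)
        _ ≤ ∑ m ∈ Finset.range (N + 1), (1 + |s|) ^ (N - 2) * (N.choose m : ℝ) :=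
            Finset.sum_le_sum_of_subset_of_nonneg
              (Finset.range_mono (by omega)) fun _ _ _ => by positivity
        _ = _ := by
            rw [← Finset.mul_sum, ← Nat.cast_sum, Nat.sum_range_choose]; push_cast; ring
    have hκn : ‖(κ : ℂ)‖ = 1 := by
      rw [norm_real, Real.norm_eq_abs]
      rcases hκ.2 ⟨q, hq⟩ with h | h <;> simp [h]
    rw [hexp, mul_add, mul_add, add_re, add_re, hA, hB, ofReal_re]
    have hD : (κ * ∑ m ∈ Finset.range (N - 1),
        (I * s) ^ m * (c : ℂ) ^ (N - m) * (N.choose m : ℂ)).re ≤ 2 ^ N * (1 + |s|) ^ (N - 2) := by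
      refine (re_le_norm _).trans ?_
      rw [norm_mul, hκn, one_mul]; exact hC
    have e4 : N - 2 + 1 = N - 1 := by omega
    rw [e4]
    have h6 : (1 : ℝ) * |s| ^ (N - 1) ≤ (N : ℝ) * |s| ^ (N - 1) := by
      gcongr; exact_mod_cast (by omega : 1 ≤ N)
    linarith

theorem exists_phase_bound {N : ℕ} (hN : 2 ≤ N) {κ : ℝ} (hκ : IsHeatSign N κ) {R : ℝ}
    (hR : 0 ≤ R) :
    ∃ C : ℝ, ∀ s : ℝ, (κ * airyPt N κ s ^ N).re ≤ C - R * |s| := by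
  obtain ⟨d, hd, D, hD, h⟩ := re_phase_le hN hκ
  obtain ⟨C, hC⟩ := exists_bound_sub_pow d hd hD hR
  exact ⟨C, fun s => by linarith [h s, hC |s| (abs_nonneg s)]⟩

/-- The integrand `ξ^j exp(zξ + κ ξ^N)` at `ξ = c + is`. -/
noncomputable def airyIntegrand (N : ℕ) (κ : ℝ) (j : ℕ) (z : ℂ) (s : ℝ) : ℂ :=
  airyPt N κ s ^ j * exp (z * airyPt N κ s + κ * airyPt N κ s ^ N)

theorem continuous_airyPt (N : ℕ) (κ : ℝ) : Continuous (airyPt N κ) := by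
  unfold airyPt; fun_prop

theorem continuous_airyIntegrand (N : ℕ) (κ : ℝ) (j : ℕ) (z : ℂ) :
    Continuous (airyIntegrand N κ j z) := by
  have := continuous_airyPt N κ
  unfold airyIntegrand; fun_prop

theorem norm_airyPt_le (N : ℕ) (κ s : ℝ) : ‖airyPt N κ s‖ ≤ |airyAbscissa N κ| + |s| := by
  refine (norm_add_le _ _).trans ?_
  simp

theorem integrable_exp_neg_abs_id : Integrable fun s : ℝ => Real.exp (-|s|) := by
  have h : Integrable fun s : ℝ => (1 + s ^ 2 : ℝ)⁻¹ * 2 := integrable_inv_one_add_sq.mul_const 2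
  refine h.mono' (by fun_prop) (Filter.Eventually.of_forall fun s => ?_)
  rw [Real.norm_eq_abs, abs_of_pos (Real.exp_pos _), Real.exp_neg, ← div_eq_inv_mul,
    inv_le_comm₀ (Real.exp_pos _) (by positivity), inv_div]
  have := Real.quadratic_le_exp_of_nonneg (abs_nonneg s)
  have h2 : |s| ^ 2 = s ^ 2 := sq_abs s
  have := abs_nonneg s
  linarith

theorem exists_airyIntegrand_bound {N : ℕ} (hN : 2 ≤ N) {κ : ℝ} (hκ : IsHeatSign N κ) (j : ℕ)
    (r : ℝ) : ∃ C : ℝ, ∀ z : ℂ, ‖z‖ ≤ r → ∀ s : ℝ,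
      ‖airyIntegrand N κ j z s‖ ≤ C * Real.exp (-|s|) := by
  wlog hr : 0 ≤ r
  · exact ⟨0, fun z hz => absurd ((norm_nonneg z).trans hz) hr⟩
  -- Of this slope, `r` absorbs `exp(zξ)`, `j` absorbs the factor `ξ^j`, and `1` is left as the
  -- decay rate.
  obtain ⟨C, hC⟩ := exists_phase_bound hN hκ (R := r + j + 1) (by positivity)
  set a := |airyAbscissa N κ| with ha
  refine ⟨Real.exp (j * a + r * a + C), fun z hz s => ?_⟩
  rw [airyIntegrand, norm_mul, norm_pow, norm_exp]
  have h1 := norm_airyPt_le N κ s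
  have h2 : ‖airyPt N κ s‖ ^ j ≤ Real.exp (j * (a + |s|)) := by
    rw [Real.exp_nat_mul]
    gcongr
    exact h1.trans ((by linarith : a + |s| ≤ (a + |s|) + 1).trans (Real.add_one_le_exp _))
  have h3 : (z * airyPt N κ s).re ≤ r * (a + |s|) :=
    (re_le_norm _).trans (by rw [norm_mul]; gcongr)
  calc _ ≤ Real.exp (j * (a + |s|)) *
        Real.exp (r * (a + |s|) + (C - (r + j + 1) * |s|)) := by
        gcongr
        rw [add_re]
        exact add_le_add h3 (hC s)
    _ = _ := by rw [← Real.exp_add, ← Real.exp_add]; congr 1; ring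

theorem integrable_airyIntegrand {N : ℕ} (hN : 2 ≤ N) {κ : ℝ} (hκ : IsHeatSign N κ) (j : ℕ)
    (z : ℂ) : Integrable (airyIntegrand N κ j z) := by
  obtain ⟨C, hC⟩ := exists_airyIntegrand_bound hN hκ j ‖z‖
  exact (integrable_exp_neg_abs_id.const_mul C).mono'
    (continuous_airyIntegrand N κ j z).aestronglyMeasurable
    (Filter.Eventually.of_forall fun s => hC z le_rfl s)

/-- The `j`-th derivative of the Airy-type function, as an entire function. -/
noncomputable def airyEntire (N : ℕ) (κ : ℝ) (j : ℕ) (z : ℂ) : ℂ :=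
  (1 / (2 * Real.pi) : ℂ) * ∫ s : ℝ, airyIntegrand N κ j z s

theorem hasDerivAt_airyEntire {N : ℕ} (hN : 2 ≤ N) {κ : ℝ} (hκ : IsHeatSign N κ) (j : ℕ)
    (z : ℂ) : HasDerivAt (airyEntire N κ j) (airyEntire N κ (j + 1) z) z := by
  obtain ⟨C, hC⟩ := exists_airyIntegrand_bound hN hκ (j + 1) (‖z‖ + 1)
  refine HasDerivAt.const_mul _ ?_
  refine (hasDerivAt_integral_of_dominated_loc_of_deriv_le
    (bound := fun s => C * Real.exp (-|s|)) (Metric.ball_mem_nhds z one_pos)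
    (Filter.Eventually.of_forall fun w =>
      (continuous_airyIntegrand N κ j w).aestronglyMeasurable)
    (integrable_airyIntegrand hN hκ j z)
    (continuous_airyIntegrand N κ (j + 1) z).aestronglyMeasurable
    (Filter.Eventually.of_forall fun s w hw => hC w ?_ s)
    (integrable_exp_neg_abs_id.const_mul C)
    (Filter.Eventually.of_forall fun s w _ => ?_)).2
  · have := norm_sub_norm_le w z
    rw [Metric.mem_ball, dist_eq_norm] at hw
    linarith
  · unfold airyIntegrand
    have h : HasDerivAt (fun w : ℂ => w * airyPt N κ s + κ * airyPt N κ s ^ N)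
        (1 * airyPt N κ s) w := ((hasDerivAt_id w).mul_const _).add_const _
    have h2 := h.cexp.const_mul (airyPt N κ s ^ j)
    refine h2.congr_deriv ?_
    rw [pow_succ]
    ring

theorem airyFun_eq (N : ℕ) (κ z : ℝ) : airyFun N κ z = airyEntire N κ 0 z := by
  simp [airyFun, airyEntire, airyIntegrand, airyPt]

theorem iteratedDeriv_airyFun {N : ℕ} (hN : 2 ≤ N) {κ : ℝ} (hκ : IsHeatSign N κ) (j : ℕ) :
    iteratedDeriv j (airyFun N κ) = fun z : ℝ => airyEntire N κ j z := by
  induction j with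
  | zero => funext z; simp [airyFun_eq]
  | succ j ih =>
    funext z
    rw [iteratedDeriv_succ, ih]
    exact (hasDerivAt_airyEntire hN hκ j z).comp_ofReal.deriv

theorem hasDerivAt_airyPt (N : ℕ) (κ s : ℝ) : HasDerivAt (airyPt N κ) I s := by
  have h := (((hasDerivAt_id (s : ℂ)).const_mul I).const_add (airyAbscissa N κ : ℂ)).comp_ofReal
  rw [mul_one] at h
  exact h

/-- The Airy-type equation `A^{(N-1)}(z) = -(κ/N) z A(z)`, in the form `z A + κ N A^{(N-1)} = 0`. -/
theorem airyEntire_equation {N : ℕ} (hN : 2 ≤ N) {κ : ℝ} (hκ : IsHeatSign N κ) (z : ℂ) :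
    z * airyEntire N κ 0 z + κ * N * airyEntire N κ (N - 1) z = 0 := by
  have h0 := integrable_airyIntegrand hN hκ 0 z
  have h1 := integrable_airyIntegrand hN hκ (N - 1) z
  have hd : ∀ s : ℝ, HasDerivAt (airyIntegrand N κ 0 z)
      (I * (z * airyIntegrand N κ 0 z s + κ * N * airyIntegrand N κ (N - 1) z s)) s := by
    intro s
    unfold airyIntegrand
    simp only [pow_zero, one_mul]
    have hp := hasDerivAt_airyPt N κ s
    have h := ((hp.const_mul z).fun_add ((hp.fun_pow N).const_mul (κ : ℂ))).cexp
    refine h.congr_deriv ?_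
    ring
  -- The derivative of `exp(zξ + κξ^N)` along the line has integral zero.
  have h := integral_eq_zero_of_hasDerivAt_of_integrable hd
    (((h0.const_mul z).add (h1.const_mul _)).const_mul I) h0
  rw [integral_const_mul, integral_add (h0.const_mul z) (h1.const_mul _), integral_const_mul,
    integral_const_mul] at h
  have h' := (mul_eq_zero.1 h).resolve_left I_ne_zero
  unfold airyEntire
  linear_combination (1 / (2 * Real.pi) : ℂ) * h'

/-- Differentiate the Airy-type equation `m` times. For `m = 0` the truncated index `m - 1` is
harmless because of the factor `m`. -/
theorem airyEntire_recurrence {N : ℕ} (hN : 2 ≤ N) {κ : ℝ} (hκ : IsHeatSign N κ) (m : ℕ) (z : ℂ) :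
    z * airyEntire N κ m z + m * airyEntire N κ (m - 1) z +
      κ * N * airyEntire N κ (N - 1 + m) z = 0 := by
  induction m generalizing z with
  | zero => simpa using airyEntire_equation hN hκ z
  | succ m ih =>
    have hf : (fun z => z * airyEntire N κ m z + m * airyEntire N κ (m - 1) z +
      κ * N * airyEntire N κ (N - 1 + m) z) = fun _ => 0 := funext ih
    have hm : HasDerivAt (fun z => (m : ℂ) * airyEntire N κ (m - 1) z)
        (m * airyEntire N κ m z) z := by
      rcases m with _ | m
      · simpa using hasDerivAt_const z (0 : ℂ)
      · exact (hasDerivAt_airyEntire hN hκ m z).const_mul _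
    have hd := (((hasDerivAt_id z).mul (hasDerivAt_airyEntire hN hκ m z)).add hm).add
      ((hasDerivAt_airyEntire hN hκ (N - 1 + m) z).const_mul ((κ : ℂ) * N))
    have hu := hd.unique ((hasDerivAt_const z (0 : ℂ)).congr_of_eventuallyEq
      (Filter.Eventually.of_forall fun w => ih w))
    simp only [Nat.add_sub_cancel]
    push_cast
    rw [← add_assoc]
    simp only [id] at hu
    linear_combination hu

/-- On the real line `A` is, up to an exponential factor and a rescaling, the Fourier transform of
the continuous integrable function `exp(κ(c + is)^N)`. Were it zero, Fourier inversion would make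
this function zero at `s = 0`. -/
theorem exists_airyEntire_ne_zero {N : ℕ} (hN : 2 ≤ N) {κ : ℝ} (hκ : IsHeatSign N κ) :
    ∃ z : ℝ, airyEntire N κ 0 z ≠ 0 := by
  by_contra! h
  let φ : ℝ → ℂ := airyIntegrand N κ 0 0
  have hφc : Continuous φ := continuous_airyIntegrand N κ 0 0
  have hφi : Integrable φ := integrable_airyIntegrand hN hκ 0 0
  have hF : FourierTransform.fourier φ = 0 := by
    funext w
    rw [Real.fourier_eq']
    have h1 := h (-(2 * Real.pi * w))
    unfold airyEntire at h1
    have h2 := (mul_eq_zero.1 h1).resolve_left (by simp [Real.pi_ne_zero])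
    have h3 : (fun s : ℝ => airyIntegrand N κ 0 ((-(2 * Real.pi * w) : ℝ) : ℂ) s) = fun s =>
        exp ((-(2 * Real.pi * w) : ℝ) * airyAbscissa N κ) *
        (exp (↑(-2 * Real.pi * inner ℝ s w) * I) • φ s) := by
      funext s
      simp only [φ, airyIntegrand, smul_eq_mul, pow_zero, one_mul, zero_mul, zero_add]
      rw [← exp_add, ← exp_add]
      congr 1
      simp [airyPt]
      ring
    rw [h3, integral_const_mul] at h2
    exact (mul_eq_zero.1 h2).resolve_left (exp_ne_zero _)
  have hinv := hφc.fourierInv_fourier_eq hφi (by rw [hF]; exact integrable_zero _ _ _)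
  have h0 : φ 0 = 0 := by
    rw [← hinv, hF, Real.fourierInv_eq']; simp
  simp [φ, airyIntegrand] at h0

/-- The Airy-type function does not vanish identically near any point. -/
theorem airyEntire_not_eventually_zero {N : ℕ} (hN : 2 ≤ N) {κ : ℝ} (hκ : IsHeatSign N κ) (a : ℝ) :
    ¬ ∀ᶠ z : ℝ in nhds a, airyEntire N κ 0 z = 0 := by
  intro h
  have hd : Differentiable ℂ (airyEntire N κ 0) := fun z =>
    (hasDerivAt_airyEntire hN hκ 0 z).differentiableAt
  have ha : AnalyticOnNhd ℂ (airyEntire N κ 0) Set.univ :=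
    fun z _ => hd.analyticAt z
  have hfreq : ∃ᶠ w in nhdsWithin (a : ℂ) {(a : ℂ)}ᶜ, airyEntire N κ 0 w = 0 := by
    have ht : Filter.Tendsto (fun r : ℝ => (r : ℂ)) (nhdsWithin a {a}ᶜ)
        (nhdsWithin (a : ℂ) {(a : ℂ)}ᶜ) := by
      refine tendsto_nhdsWithin_iff.2 ⟨(continuous_ofReal.tendsto a).mono_left
        nhdsWithin_le_nhds, ?_⟩
      filter_upwards [self_mem_nhdsWithin] with r hr
      simpa using hr
    exact ht.frequently (h.filter_mono nhdsWithin_le_nhds).frequently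
  have := ha.eqOn_zero_of_preconnected_of_frequently_eq_zero isPreconnected_univ
    (Set.mem_univ _) hfreq
  obtain ⟨z, hz⟩ := exists_airyEntire_ne_zero hN hκ
  exact hz (this (Set.mem_univ _))

end AiryFunction

/-! ### Linear independence of the rescaled Airy derivatives off the diagonal. -/

section Independence

open Polynomial

/-- The value at `z` of `f(∂) A`, for a polynomial `f`. -/
noncomputable def airyDiffOp (N : ℕ) (κ : ℝ) (z : ℝ) : ℂ[X] →ₗ[ℂ] ℂ :=
  (Polynomial.basisMonomials ℂ).constr ℂ fun m => airyEntire N κ m z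

theorem airyDiffOp_monomial (N : ℕ) (κ z : ℝ) (m : ℕ) (a : ℂ) :
    airyDiffOp N κ z (monomial m a) = a * airyEntire N κ m z := by
  have h : (monomial m a : ℂ[X]) = a • Polynomial.basisMonomials ℂ m := by
    simp [smul_monomial]
  rw [h, map_smul, airyDiffOp, Module.Basis.constr_basis, smul_eq_mul]

theorem hasDerivAt_airyDiffOp {N : ℕ} (hN : 2 ≤ N) {κ : ℝ} (hκ : IsHeatSign N κ) (f : ℂ[X])
    (z : ℝ) : HasDerivAt (fun w => airyDiffOp N κ w f) (airyDiffOp N κ z (X * f)) z := by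
  induction f using Polynomial.induction_on' with
  | add p q hp hq => simpa [mul_add] using hp.fun_add hq
  | monomial m a =>
    simp only [X_mul_monomial, airyDiffOp_monomial]
    exact ((hasDerivAt_airyEntire hN hκ m z).const_mul a).comp_ofReal

/-- The action of multiplication by `z` on the polynomials `f(∂)` applied to `A`. -/
noncomputable def airyMulZ (N : ℕ) (κ : ℝ) (f : ℂ[X]) : ℂ[X] :=
  C (-(κ * N) : ℂ) * X ^ (N - 1) * f - derivative f

theorem mul_airyDiffOp {N : ℕ} (hN : 2 ≤ N) {κ : ℝ} (hκ : IsHeatSign N κ) (f : ℂ[X]) (z : ℝ) :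
    z * airyDiffOp N κ z f = airyDiffOp N κ z (airyMulZ N κ f) := by
  induction f using Polynomial.induction_on' with
  | add p q hp hq =>
    have : airyMulZ N κ (p + q) = airyMulZ N κ p + airyMulZ N κ q := by
      simp only [airyMulZ, derivative_add]; ring
    rw [this, map_add, map_add, mul_add, hp, hq]
  | monomial m a =>
    rw [airyMulZ, map_sub, C_mul_X_pow_eq_monomial, monomial_mul_monomial, derivative_monomial,
      airyDiffOp_monomial, airyDiffOp_monomial, airyDiffOp_monomial]
    linear_combination a * airyEntire_recurrence hN hκ m z

theorem pow_mul_airyDiffOp {N : ℕ} (hN : 2 ≤ N) {κ : ℝ} (hκ : IsHeatSign N κ) (f : ℂ[X]) (z : ℝ)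
    (a : ℕ) : (z : ℂ) ^ a * airyDiffOp N κ z f = airyDiffOp N κ z ((airyMulZ N κ)^[a] f) := by
  induction a with
  | zero => simp
  | succ a ih =>
    rw [Function.iterate_succ_apply', ← mul_airyDiffOp hN hκ, ← ih]; ring

theorem degree_airyMulZ {N : ℕ} (hN : 2 ≤ N) {κ : ℝ} (hκ : IsHeatSign N κ) {f : ℂ[X]}
    (hf : f ≠ 0) : (airyMulZ N κ f).degree = f.degree + (N - 1 : ℕ) := by
  have hc : (-(κ * N) : ℂ) ≠ 0 := by
    have h1 := isHeatSign_sq_eq_one hκ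
    have h2 : κ ≠ 0 := by rintro rfl; norm_num at h1
    have h3 : N ≠ 0 := by omega
    simp [h2, h3]
  have h : (C (-(κ * N) : ℂ) * X ^ (N - 1) * f).degree = f.degree + (N - 1 : ℕ) := by
    rw [degree_mul, degree_C_mul_X_pow _ hc, add_comm]
  rw [airyMulZ, degree_sub_eq_left_of_degree_lt, h]
  rw [h]
  refine (degree_derivative_lt hf).trans_le ?_
  exact le_add_of_nonneg_right (by exact_mod_cast Nat.zero_le _)

theorem degree_airyMulZ_iterate {N : ℕ} (hN : 2 ≤ N) {κ : ℝ} (hκ : IsHeatSign N κ) (j a : ℕ) :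
    ((airyMulZ N κ)^[a] (X ^ j)).degree = (((N - 1) * a + j : ℕ) : WithBot ℕ) := by
  induction a with
  | zero => simp
  | succ a ih =>
    have h0 : (airyMulZ N κ)^[a] (X ^ j) ≠ 0 := by
      intro h; rw [h, degree_zero] at ih; exact (WithBot.bot_ne_coe ih).elim
    rw [Function.iterate_succ_apply', degree_airyMulZ hN hκ h0, ih, ← Nat.cast_add]
    congr 1; ring

/-- The `f` with `f(∂)A = 0` on `Z` are stable under multiplication by `X` (differentiate in `z`),
and then under `f ↦ f'` (multiply by `z` and use `mul_airyDiffOp`). A nonzero one could be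
differentiated down to a nonzero constant, giving `A = 0` on `Z`. -/
theorem exists_airyDiffOp_ne_zero {N : ℕ} (hN : 2 ≤ N) {κ : ℝ} (hκ : IsHeatSign N κ) {Z : Set ℝ}
    (hZ : IsOpen Z) (hZ' : Z.Nonempty) {f : ℂ[X]} (hf : f ≠ 0) :
    ∃ z ∈ Z, airyDiffOp N κ z f ≠ 0 := by
  induction hn : f.natDegree generalizing f with
  | zero =>
    obtain ⟨a, ha⟩ := hZ'
    rw [natDegree_eq_zero] at hn
    obtain ⟨c, rfl⟩ := hn
    have hc : c ≠ 0 := by rintro rfl; simp at hf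
    by_contra! h
    refine airyEntire_not_eventually_zero hN hκ a ?_
    filter_upwards [hZ.mem_nhds ha] with z hz
    have := h z hz
    rw [← monomial_zero_left, airyDiffOp_monomial] at this
    exact (mul_eq_zero.1 this).resolve_left hc
  | succ n ih =>
    by_contra! h
    have hX : ∀ g : ℂ[X], (∀ z ∈ Z, airyDiffOp N κ z g = 0) →
        ∀ z ∈ Z, airyDiffOp N κ z (X * g) = 0 := by
      intro g hg z hz
      refine (hasDerivAt_airyDiffOp hN hκ g z).unique
        ((hasDerivAt_const z (0 : ℂ)).congr_of_eventuallyEq ?_)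
      filter_upwards [hZ.mem_nhds hz] with w hw using hg w hw
    have hXn : ∀ m : ℕ, ∀ z ∈ Z, airyDiffOp N κ z (X ^ m * f) = 0 := by
      intro m
      induction m with
      | zero => simpa using h
      | succ m ihm =>
        rw [pow_succ', mul_assoc]; exact hX _ ihm
    have hder : ∀ z ∈ Z, airyDiffOp N κ z (derivative f) = 0 := by
      intro z hz
      have h1 := mul_airyDiffOp hN hκ f z
      rw [h z hz, mul_zero, airyMulZ, map_sub, mul_assoc, ← smul_eq_C_mul, map_smul, hXn _ z hz,
        smul_zero, zero_sub, eq_comm, neg_eq_zero] at h1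
      exact h1
    have hnd : (derivative f).natDegree = n := by
      rw [natDegree_derivative, hn]; rfl
    have hne : derivative f ≠ 0 := by
      intro h0
      have := derivative_eq_zero.1 h0
      omega
    obtain ⟨z, hz, hz'⟩ := ih hne hnd
    exact hz' (hder z hz)

theorem airyTerm_eq {N : ℕ} (hN : 2 ≤ N) {κ : ℝ} (hκ : IsHeatSign N κ) (j : ℕ) (x y : ℝ)
    {τ : ℝ} (hτ : 0 < τ) :
    airyTerm N κ j x y (τ ^ N) = ((τ : ℂ) ^ (j + 1))⁻¹ * airyEntire N κ j ((x - y) / τ : ℝ) := by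
  have hN0 : (N : ℝ) ≠ 0 := by exact_mod_cast (by omega : N ≠ 0)
  have h1 : (τ ^ N) ^ ((1 : ℝ) / N) = τ := by
    rw [← Real.rpow_natCast, ← Real.rpow_mul hτ.le, mul_one_div_cancel hN0, Real.rpow_one]
  have h2 : (τ ^ N) ^ (-((j : ℝ) + 1) / N) = (τ ^ (j + 1))⁻¹ := by
    rw [← Real.rpow_natCast, ← Real.rpow_mul hτ.le, mul_div_cancel₀ _ hN0, Real.rpow_neg hτ.le]
    congr 1
    exact_mod_cast Real.rpow_natCast τ (j + 1)
  rw [airyTerm, h1, h2, iteratedDeriv_airyFun hN hκ]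
  push_cast
  rfl

/-- For `x ≠ y` the functions `t^k · t^{-(j+1)/N} A^{(j)}((x-y)/t^{1/N})`, `j ≤ N - 2`, are linearly
independent over `t > 0`. -/
theorem airyTerm_linearIndependent {N : ℕ} (hN : 2 ≤ N) {κ : ℝ} (hκ : IsHeatSign N κ) {x y : ℝ}
    (hxy : x ≠ y) (M : ℕ) (c : ℕ → ℕ → ℂ)
    (h : ∀ t : ℝ, 0 < t → ∑ k ∈ Finset.range (M + 1), ∑ j ∈ Finset.range (N - 1),
      c k j * ((t : ℂ) ^ k * airyTerm N κ j x y t) = 0) :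
    ∀ k ≤ M, ∀ j < N - 1, c k j = 0 := by
  set s : ℝ := x - y with hs
  have hs0 : s ≠ 0 := sub_ne_zero.2 hxy
  have hsC : (s : ℂ) ≠ 0 := by exact_mod_cast hs0
  -- The substitution `t = (s/z)^N` turns the argument of `A^{(j)}` into the free variable `z`.
  let Z : Set ℝ := {z | 0 < s / z}
  have hZ : IsOpen Z := by
    have : Z = {z | 0 < s * z} := by
      ext z
      simp only [Z, Set.mem_ofPred_eq, div_pos_iff, mul_pos_iff]
    rw [this]
    exact isOpen_lt continuous_const (by fun_prop)
  have hZ' : Z.Nonempty := ⟨s, by simp [Z, hs0]⟩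
  -- After multiplication by `z^(NM)` the `(k, j)` term carries `z^(N(M-k)+j+1)`, and each power of
  -- `z` becomes an application of `airyMulZ`.
  let F : ℕ × ℕ → ℂ[X] := fun p =>
    (c p.1 p.2 * (s : ℂ) ^ (N * p.1) * ((s : ℂ) ^ (p.2 + 1))⁻¹) •
      (airyMulZ N κ)^[N * (M - p.1) + p.2 + 1] (X ^ p.2)
  let T : Finset (ℕ × ℕ) := Finset.range (M + 1) ×ˢ Finset.range (N - 1)
  have hvan : ∀ z ∈ Z, airyDiffOp N κ z (∑ p ∈ T, F p) = 0 := by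
    intro z hz
    have hz0 : z ≠ 0 := by rintro rfl; simp [Z] at hz
    have hzC : (z : ℂ) ≠ 0 := by exact_mod_cast hz0
    have h1 := h ((s / z) ^ N) (pow_pos hz N)
    rw [← Finset.sum_product' (f := fun k j => c k j *
      ((((s / z) ^ N : ℝ) : ℂ) ^ k * airyTerm N κ j x y ((s / z) ^ N)))] at h1
    have h2 : airyDiffOp N κ z (∑ p ∈ T, F p) = (z : ℂ) ^ (N * M) * 0 := by
      rw [← h1, map_sum, Finset.mul_sum]
      refine Finset.sum_congr rfl fun p hp => ?_
      have hp1 : p.1 ≤ M := by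
        have := (Finset.mem_product.1 hp).1
        rw [Finset.mem_range] at this; omega
      rw [map_smul, ← pow_mul_airyDiffOp hN hκ, ← monomial_one_right_eq_X_pow,
        airyDiffOp_monomial, airyTerm_eq hN hκ _ _ _ hz, ← hs, div_div_cancel₀ hs0]
      have e : N * M = N * p.1 + N * (M - p.1) := by rw [← mul_add]; congr 1; omega
      rw [e, smul_eq_mul]
      push_cast
      simp only [div_pow, ← pow_mul, pow_add, pow_one]
      field_simp
    rw [h2, mul_zero]
  have hsum : ∑ p ∈ T, F p = 0 := by
    by_contra hne
    obtain ⟨z, hz, hz'⟩ := exists_airyDiffOp_ne_zero hN hκ hZ hZ' hne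
    exact hz' (hvan z hz)
  have hdeg0 := fun j a => degree_airyMulZ_iterate hN hκ j a
  have hdeg : ∀ p : ℕ × ℕ, F p ≠ 0 → (F p).degree =
      (((N - 1) * (N * (M - p.1) + p.2 + 1) + p.2 : ℕ) : WithBot ℕ) := by
    intro p hp
    have hc : c p.1 p.2 * (s : ℂ) ^ (N * p.1) * ((s : ℂ) ^ (p.2 + 1))⁻¹ ≠ 0 := by
      intro h0; apply hp; simp only [F, h0, zero_smul]
    rw [← hdeg0]
    simp only [F]
    rw [smul_eq_C_mul, degree_mul, degree_C hc, zero_add]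
  have hpair : Set.Pairwise {p | p ∈ T ∧ F p ≠ 0} (Function.onFun Ne (degree ∘ F)) := by
    rintro p ⟨hp, hp0⟩ q ⟨hq, hq0⟩ hpq heq
    simp only [Function.comp, hdeg p hp0, hdeg q hq0] at heq
    rw [Nat.cast_inj] at heq
    obtain ⟨n, rfl⟩ : ∃ n, N = n + 1 := ⟨N - 1, by omega⟩
    simp only [T, Finset.mem_product, Finset.mem_range, Nat.add_sub_cancel] at hp hq heq
    apply hpq
    -- With `N = n + 1` the degree equals `(n+1)(n(M-k) + j) + n`; since `j < n`, division by `n`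
    -- recovers `k` and `j`. So the nonzero summands have distinct degrees.
    have e1 : n * (M - p.1) + p.2 = n * (M - q.1) + q.2 := by
      apply Nat.eq_of_mul_eq_mul_left (Nat.succ_pos n)
      simp only [Nat.succ_eq_add_one]
      linarith
    have e2 : p.2 = q.2 := by
      have := congrArg (· % n) e1
      simpa [Nat.mul_add_mod, Nat.mod_eq_of_lt hp.2, Nat.mod_eq_of_lt hq.2] using this
    have e3 : M - p.1 = M - q.1 := by
      rw [e2, Nat.add_right_cancel_iff] at e1
      exact Nat.eq_of_mul_eq_mul_left (by omega) e1
    exact Prod.ext (by omega) e2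
  have hsup := degree_sum_eq_of_disjoint F T hpair
  rw [hsum, degree_zero, eq_comm, Finset.sup_eq_bot_iff] at hsup
  intro k hk j hj
  have h0 : F (k, j) = 0 := degree_eq_bot.1
    (hsup (k, j) (Finset.mem_product.2 ⟨Finset.mem_range.2 (by omega), Finset.mem_range.2 hj⟩))
  rcases smul_eq_zero.1 h0 with h1 | h1
  · simpa [hsC] using h1
  · have := hdeg0 j (N * (M - k) + j + 1)
    simp only at h1
    rw [h1, degree_zero] at this
    exact (WithBot.bot_ne_coe this).elim

end Independence

/-! ### Derivatives of the rescaled Airy terms in `x` and `t`. -/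

section AiryCalculus

theorem airyTerm_eq_entire {N : ℕ} (hN : 2 ≤ N) {κ : ℝ} (hκ : IsHeatSign N κ) (j : ℕ) (x y t : ℝ) :
    airyTerm N κ j x y t = ((t ^ (-((j : ℝ) + 1) / N) : ℝ) : ℂ) *
      airyEntire N κ j ((x - y) / t ^ ((1 : ℝ) / N) : ℝ) := by
  rw [airyTerm, iteratedDeriv_airyFun hN hκ]

theorem hasDerivAt_airyTerm_left {N : ℕ} (hN : 2 ≤ N) {κ : ℝ} (hκ : IsHeatSign N κ) (j : ℕ)
    (x y : ℝ) {t : ℝ} (ht : 0 < t) :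
    HasDerivAt (fun ξ => airyTerm N κ j ξ y t) (airyTerm N κ (j + 1) x y t) x := by
  have hN0 : (N : ℝ) ≠ 0 := by exact_mod_cast (by omega : N ≠ 0)
  simp only [airyTerm_eq_entire hN hκ]
  have h1 : HasDerivAt (fun ξ : ℝ => (ξ - y) / t ^ ((1 : ℝ) / N)) (1 / t ^ ((1 : ℝ) / N)) x :=
    ((hasDerivAt_id x).sub_const y).div_const _
  have h2 := ((hasDerivAt_airyEntire hN hκ j
    (((x - y) / t ^ ((1 : ℝ) / N) : ℝ) : ℂ)).comp x h1.ofReal_comp).const_mul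
      ((t ^ (-((j : ℝ) + 1) / N) : ℝ) : ℂ)
  refine h2.congr_deriv ?_
  have e : t ^ (-(((j + 1 : ℕ) : ℝ) + 1) / N) =
      t ^ (-((j : ℝ) + 1) / N) * (1 / t ^ ((1 : ℝ) / N)) := by
    rw [one_div (t ^ _), ← Real.rpow_neg ht.le, ← Real.rpow_add ht]
    congr 1; push_cast; field_simp; ring
  rw [e]
  push_cast
  ring

theorem iteratedDeriv_airyTerm {N : ℕ} (hN : 2 ≤ N) {κ : ℝ} (hκ : IsHeatSign N κ) (j l : ℕ)
    (y : ℝ) {t : ℝ} (ht : 0 < t) :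
    iteratedDeriv l (fun ξ => airyTerm N κ j ξ y t) = fun ξ => airyTerm N κ (j + l) ξ y t := by
  induction l with
  | zero => simp
  | succ l ih =>
    rw [iteratedDeriv_succ, ih]
    funext ξ
    exact (hasDerivAt_airyTerm_left hN hκ (j + l) ξ y ht).deriv

theorem contDiff_airyTerm {N : ℕ} (hN : 2 ≤ N) {κ : ℝ} (hκ : IsHeatSign N κ) (j : ℕ)
    (y : ℝ) {t : ℝ} (ht : 0 < t) : ContDiff ℝ ∞ fun ξ => airyTerm N κ j ξ y t := by
  refine contDiff_of_differentiable_iteratedDeriv fun m _ => ?_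
  rw [iteratedDeriv_airyTerm hN hκ j m y ht]
  exact fun ξ => (hasDerivAt_airyTerm_left hN hκ (j + m) ξ y ht).differentiableAt

theorem airyTerm_recurrence {N : ℕ} (hN : 2 ≤ N) {κ : ℝ} (hκ : IsHeatSign N κ) (m : ℕ)
    (x y : ℝ) {t : ℝ} (ht : 0 < t) :
    (x - y : ℝ) * airyTerm N κ m x y t + m * airyTerm N κ (m - 1) x y t +
      κ * N * t * airyTerm N κ (N - 1 + m) x y t = 0 := by
  have hN0 : N ≠ 0 := by omega
  obtain ⟨τ, hτ, rfl⟩ : ∃ τ : ℝ, 0 < τ ∧ τ ^ N = t :=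
    ⟨t ^ ((N : ℝ)⁻¹), Real.rpow_pos_of_pos ht _, Real.rpow_inv_natCast_pow ht.le hN0⟩
  rw [airyTerm_eq hN hκ _ _ _ hτ, airyTerm_eq hN hκ _ _ _ hτ, airyTerm_eq hN hκ _ _ _ hτ]
  have hr := airyEntire_recurrence hN hκ m (((x - y) / τ : ℝ) : ℂ)
  have hτC : (τ : ℂ) ≠ 0 := by exact_mod_cast hτ.ne'
  have e : N - 1 + m + 1 = N + m := by omega
  rw [e]
  generalize airyEntire N κ m (((x - y) / τ : ℝ) : ℂ) = a at *
  generalize airyEntire N κ (N - 1 + m) (((x - y) / τ : ℝ) : ℂ) = b at *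
  rcases m with _ | m
  · push_cast at *
    simp only [pow_one, zero_mul, add_zero] at *
    field_simp at *
    linear_combination hr
  · simp only [Nat.add_sub_cancel] at *
    generalize airyEntire N κ m (((x - y) / τ : ℝ) : ℂ) = d at *
    push_cast at *
    field_simp at *
    linear_combination (τ : ℂ) ^ 2 * (τ : ℂ) ^ (2 * m) * (τ : ℂ) ^ N * hr

/-- By homogeneity, `t ∂_t` acts as `-(1/N)((j+1) + (x-y) ∂_x)`, and `airyTerm_recurrence` at `j +
1` rewrites this as `κ t ∂_x^N`. -/
theorem hasDerivAt_airyTerm_time {N : ℕ} (hN : 2 ≤ N) {κ : ℝ} (hκ : IsHeatSign N κ) (j : ℕ)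
    (x y : ℝ) {t : ℝ} (ht : 0 < t) :
    HasDerivAt (fun τ => airyTerm N κ j x y τ) (κ * airyTerm N κ (j + N) x y t) t := by
  have hN0 : (N : ℝ) ≠ 0 := by exact_mod_cast (by omega : N ≠ 0)
  have hNC : (N : ℂ) ≠ 0 := by exact_mod_cast (by omega : N ≠ 0)
  have htC : (t : ℂ) ≠ 0 := by exact_mod_cast ht.ne'
  have hrec := airyTerm_recurrence hN hκ (j + 1) x y ht
  have hκ2 : (κ : ℂ) ^ 2 = 1 := by exact_mod_cast isHeatSign_sq_eq_one hκ
  have hp := fun a : ℝ => Real.hasDerivAt_rpow_const (x := t) (p := a) (Or.inl ht.ne')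
  have h1 : HasDerivAt (fun τ : ℝ => (x - y) / τ ^ ((1 : ℝ) / N))
      (-((x - y) * t ^ (-(1 : ℝ) / N) / (N * t))) t := by
    have h := (hp (-(1 : ℝ) / N)).const_mul (x - y)
    refine (h.congr_deriv ?_).congr_of_eventuallyEq ?_
    · rw [Real.rpow_sub_one ht.ne']; field_simp
    · filter_upwards [lt_mem_nhds ht] with τ hτ
      rw [neg_div, Real.rpow_neg hτ.le, div_eq_mul_inv]
  have h2 := (hp (-((j : ℝ) + 1) / N)).ofReal_comp.mul
    ((hasDerivAt_airyEntire hN hκ j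
      (((x - y) / t ^ ((1 : ℝ) / N) : ℝ) : ℂ)).comp t h1.ofReal_comp)
  have hfun : (fun τ => airyTerm N κ j x y τ) = (fun τ : ℝ =>
      ((τ ^ (-((j : ℝ) + 1) / N) : ℝ) : ℂ)) * ((airyEntire N κ j) ∘ fun τ : ℝ =>
        (((x - y) / τ ^ ((1 : ℝ) / N) : ℝ) : ℂ)) := by
    funext τ; exact airyTerm_eq_entire hN hκ j x y τ
  rw [hfun]
  refine h2.congr_deriv ?_
  have e1 : N - 1 + (j + 1) = j + N := by omega
  rw [e1] at hrec
  have e2 : airyTerm N κ (j + 1) x y t = ((t ^ (-((j : ℝ) + 1) / N) : ℝ) : ℂ) *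
      ((t ^ (-(1 : ℝ) / N) : ℝ) : ℂ) *
      airyEntire N κ (j + 1) ((x - y) / t ^ ((1 : ℝ) / N) : ℝ) := by
    rw [airyTerm_eq_entire hN hκ, ← Complex.ofReal_mul, ← Real.rpow_add ht]
    congr 3
    push_cast; field_simp; ring
  have e3 := airyTerm_eq_entire hN hκ j x y t
  rw [Nat.add_sub_cancel, e2, e3] at hrec
  rw [Real.rpow_sub_one ht.ne']
  simp only [Function.comp]
  generalize airyEntire N κ (j + 1) ((x - y) / t ^ ((1 : ℝ) / N) : ℝ) = b at *
  generalize airyEntire N κ j ((x - y) / t ^ ((1 : ℝ) / N) : ℝ) = a at *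
  generalize t ^ (-((j : ℝ) + 1) / N) = p at *
  generalize t ^ (-(1 : ℝ) / N) = q at *
  push_cast at *
  field_simp
  linear_combination (-1 : ℂ) * hrec

end AiryCalculus

/-! ### Symbols of `∂^j D_N^k` as polynomials in `x - y`. -/

section PowersOfD

open Polynomial

/-- Shift of the symbol family by one: right multiplication by `∂`. -/
noncomputable def symShift : Module.End ℂ (ℤ → ℂ[X]) := LinearMap.funLeft ℂ ℂ[X] fun p => p - 1

/-- Coefficientwise differentiation of a symbol family. -/
noncomputable def symDeriv : Module.End ℂ (ℤ → ℂ[X]) := (derivative (R := ℂ)).compLeft ℤ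

/-- Left multiplication by `∂` on symbol families. -/
noncomputable def symDel : Module.End ℂ (ℤ → ℂ[X]) := symShift + symDeriv

/-- Right multiplication by `D_N` on symbol families; the polynomial variable stands for `x - y`. -/
noncomputable def symD (N : ℕ) : Module.End ℂ (ℤ → ℂ[X]) where
  toFun q p := -(X * q (p + N - 1) + C ((p : ℂ) + 1) * q (p + N))
  map_add' q r := by funext p; simp only [Pi.add_apply]; ring
  map_smul' c q := by
    funext p
    simp only [Pi.smul_apply, RingHom.id_apply, smul_eq_C_mul]; ring

theorem symD_apply (N : ℕ) (q : ℤ → ℂ[X]) (p : ℤ) :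
    symD N q p = -(X * q (p + N - 1) + C ((p : ℂ) + 1) * q (p + N)) := rfl

theorem symDel_apply (q : ℤ → ℂ[X]) (p : ℤ) : symDel q p = q (p - 1) + derivative (q p) := rfl

/-- Left multiplications commute with right ones; this gives `symPow` a recursion in either index.
-/
theorem symDel_symD (N : ℕ) : Commute symDel (symD N) := by
  refine LinearMap.ext fun q => funext fun p => ?_
  simp only [Module.End.mul_apply, symDel_apply, symD_apply]
  have e2 : p - 1 + (N : ℤ) = p + N - 1 := by ring
  simp only [e2, derivative_neg, derivative_add, derivative_mul, derivative_X, derivative_C]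
  push_cast
  simp only [map_add, map_sub, map_one]
  ring

/-- The coefficients of the operator `∂^m`. -/
noncomputable def symOne (m : ℤ) : ℤ → ℂ[X] := fun p => if p = m then 1 else 0

/-- The coefficients of `∂^j D_N^k`, as polynomials in `x - y`. -/
noncomputable def symPow (N j k : ℕ) : ℤ → ℂ[X] := (symDel ^ j) ((symD N ^ k) (symOne 0))

theorem symPow_succ_left (N j k : ℕ) : symPow N (j + 1) k = symDel (symPow N j k) := by
  rw [symPow, pow_succ', Module.End.mul_apply, symPow]

theorem symPow_succ_right (N j k : ℕ) : symPow N j (k + 1) = symD N (symPow N j k) := by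
  rw [symPow, symPow, pow_succ', ← Module.End.mul_apply, ← Module.End.mul_apply,
    ← Module.End.mul_apply, ← mul_assoc, ((symDel_symD N).pow_left j).eq, mul_assoc]

theorem symPow_zero_right (N j : ℕ) : symPow N j 0 = symOne j := by
  induction j with
  | zero => simp [symPow]
  | succ j ih =>
    rw [symPow_succ_left, ih]
    funext p
    rw [symDel_apply]
    simp only [symOne]
    have : derivative (if p = (j : ℤ) then (1 : ℂ[X]) else 0) = 0 := by split_ifs <;> simp
    rw [this, add_zero]
    refine if_congr ?_ rfl rfl
    push_cast; omega

theorem symPow_order (N j k : ℕ) {p : ℤ} (hp : (j : ℤ) - k * (N - 1) < p) :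
    symPow N j k p = 0 := by
  induction k generalizing p with
  | zero =>
    rw [symPow_zero_right, symOne, if_neg]
    push_cast at hp; omega
  | succ k ih =>
    rw [symPow_succ_right, symD_apply, ih, ih]
    · simp
    · push_cast at hp; linarith
    · push_cast at hp; linarith

/-- Since `[∂^N, D_N] = -N`, one has `D_N^k ∂^N = ∂^N D_N^k + N k D_N^(k-1)`. This is the operator
counterpart of `∂_t` acting on `t^k` times an Airy term. -/
theorem symPow_shift (N j k : ℕ) (p : ℤ) :
    symPow N j k (p - N) = symPow N (j + N) k p + C ((N : ℂ) * k) * symPow N j (k - 1) p := by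
  induction k generalizing p with
  | zero =>
    rw [symPow_zero_right, symPow_zero_right]
    simp only [symOne, Nat.cast_zero, mul_zero, map_zero, zero_mul, add_zero]
    refine if_congr ?_ rfl rfl
    push_cast; omega
  | succ k ih =>
    rw [symPow_succ_right, symPow_succ_right, symD_apply, symD_apply, Nat.add_sub_cancel]
    have e1 : p - N + N - 1 = (p + N - 1) - (N : ℤ) := by ring
    have e2 : p - N + N = (p + N) - (N : ℤ) := by ring
    rw [e1, e2, ih, ih]
    have hk : C ((N : ℂ) * k) * symPow N j k p = -(X * (C ((N : ℂ) * k) *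
        symPow N j (k - 1) (p + N - 1)) + C ((p : ℂ) + 1) * (C ((N : ℂ) * k) *
        symPow N j (k - 1) (p + N))) := by
      rcases k with _ | k
      · simp
      · rw [symPow_succ_right, symD_apply, Nat.add_sub_cancel]; ring
    have h2 := ih (p + N)
    rw [add_sub_cancel_right] at h2
    push_cast at hk h2 ⊢
    simp only [map_add, map_sub, map_mul, map_one] at hk h2 ⊢
    linear_combination (-1 : ℂ[X]) * hk + (-C (N : ℂ)) * h2

/-- Here `∂^(N-1) D_N = -(x - y)`, and `∂^m` is then moved past `x - y`. This is the counterpart of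
`airyTerm_recurrence`. -/
theorem symPow_reduce (N m k : ℕ) (hN : 1 ≤ N) (p : ℤ) :
    symPow N (N - 1 + m) (k + 1) p =
      -(X * symPow N m k p + C (m : ℂ) * symPow N (m - 1) k p) := by
  induction k generalizing p with
  | zero =>
    rw [symPow_succ_right, symPow_zero_right, symPow_zero_right, symPow_zero_right, symD_apply]
    simp only [symOne]
    have c1 : (p + N - 1 = ((N - 1 + m : ℕ) : ℤ)) ↔ p = m := by omega
    have c2 : (p + N = ((N - 1 + m : ℕ) : ℤ)) ↔ p = m - 1 := by omega
    rw [if_congr c1 rfl rfl, if_congr c2 rfl rfl]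
    congr 2
    rcases m with _ | m
    · by_cases h : p = -1
      · simp [h]
      · rw [if_neg (by push_cast; omega)]; simp
    · by_cases h : p = m
      · rw [if_pos (by push_cast; omega), if_pos (by simpa using h), h]; push_cast; rfl
      · rw [if_neg (by push_cast; omega), if_neg (by simpa using h)]; simp
  | succ k ih =>
    rw [symPow_succ_right, symD_apply, ih, ih, symPow_succ_right, symPow_succ_right, symD_apply,
      symD_apply]
    ring

/-- At `p = -1` the factor `p + 1` in `symD` vanishes, and the other term is a multiple of `x - y`.
-/
theorem symPow_residue (N l k : ℕ) : (symPow N l (k + 1) (-1)).eval 0 = 0 := by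
  rw [symPow_succ_right, symD_apply]
  simp

/-- The coefficient of `∂^p` in `∂^i · ∑ X_q ∂^q`. -/
noncomputable def delMul (i : ℕ) (X : ℤ → ℝ → ℂ) (p : ℤ) (x : ℝ) : ℂ :=
  ∑ l ∈ Finset.range (i + 1), (i.choose l : ℂ) * iteratedDeriv l (X (p - i + l)) x

theorem symShift_pow_apply (m : ℕ) (q : ℤ → ℂ[X]) (p : ℤ) : (symShift ^ m) q p = q (p - m) := by
  induction m generalizing p with
  | zero => simp
  | succ m ih =>
    rw [pow_succ', Module.End.mul_apply]
    change (symShift ^ m) q (p - 1) = _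
    rw [ih]; congr 1; push_cast; ring

theorem symDeriv_pow_apply (m : ℕ) (q : ℤ → ℂ[X]) (p : ℤ) :
    (symDeriv ^ m) q p = derivative^[m] (q p) := by
  induction m with
  | zero => simp
  | succ m ih =>
    rw [pow_succ', Module.End.mul_apply, Function.iterate_succ_apply', ← ih]
    rfl

theorem symDel_pow_apply (j : ℕ) (q : ℤ → ℂ[X]) (p : ℤ) :
    (symDel ^ j) q p = ∑ l ∈ Finset.range (j + 1),
      C (j.choose l : ℂ) * derivative^[l] (q (p - j + l)) := by
  have hc : Commute symDeriv symShift := by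
    refine LinearMap.ext fun q => funext fun p => rfl
  rw [symDel, add_comm, hc.add_pow, LinearMap.sum_apply, Finset.sum_apply]
  refine Finset.sum_congr rfl fun l hl => ?_
  have hl' : l ≤ j := by rw [Finset.mem_range] at hl; omega
  rw [← (Nat.cast_commute (j.choose l) (symDeriv ^ l * symShift ^ (j - l))).eq]
  rw [← nsmul_eq_mul, LinearMap.smul_apply, Pi.smul_apply, Module.End.mul_apply,
    symDeriv_pow_apply, symShift_pow_apply, nsmul_eq_mul, map_natCast]
  congr 4
  push_cast [hl']; ring

theorem hasDerivAt_eval_sub (f : ℂ[X]) (x y : ℝ) :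
    HasDerivAt (fun ξ : ℝ => f.eval ((ξ - y : ℝ) : ℂ)) ((derivative f).eval ((x - y : ℝ) : ℂ)) x := by
  have h := ((f.hasDerivAt (((x - y : ℝ)) : ℂ)).comp x
    (((hasDerivAt_id x).sub_const y).ofReal_comp))
  rw [Complex.ofReal_one, mul_one] at h
  exact h

theorem iteratedDeriv_eval_sub (f : ℂ[X]) (y : ℝ) (l : ℕ) :
    iteratedDeriv l (fun ξ : ℝ => f.eval ((ξ - y : ℝ) : ℂ)) =
      fun x => (derivative^[l] f).eval ((x - y : ℝ) : ℂ) := by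
  induction l with
  | zero => simp
  | succ l ih =>
    rw [iteratedDeriv_succ, ih, Function.iterate_succ_apply']
    funext x
    exact (hasDerivAt_eval_sub _ x y).deriv

theorem contDiff_eval_sub (f : ℂ[X]) (y : ℝ) :
    ContDiff ℝ ∞ fun ξ : ℝ => f.eval ((ξ - y : ℝ) : ℂ) := by
  refine contDiff_of_differentiable_iteratedDeriv fun m _ => ?_
  rw [iteratedDeriv_eval_sub]
  exact fun x => (hasDerivAt_eval_sub _ x y).differentiableAt

theorem delMul_eval (i : ℕ) (q : ℤ → ℂ[X]) (y : ℝ) (p : ℤ) (x : ℝ) :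
    delMul i (fun p ξ => (q p).eval ((ξ - y : ℝ) : ℂ)) p x =
      ((symDel ^ i) q p).eval ((x - y : ℝ) : ℂ) := by
  rw [symDel_pow_apply, eval_finsetSum, delMul]
  refine Finset.sum_congr rfl fun l _ => ?_
  rw [iteratedDeriv_eval_sub, eval_mul, eval_C]

end PowersOfD

/-! ### Identification of the symbols with coefficients of formal operators. -/

section FPDOCoefficients

open Polynomial

theorem choose_natCast_int (n k : ℕ) : ((Ring.choose (n : ℤ) k : ℤ) : ℂ) = (n.choose k : ℂ) := by
  rw [Ring.choose_natCast]; simp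

theorem del_mul_coeff (j : ℕ) (Q : FPDO) (p : ℤ) (x : ℝ) :
    (FPDO.del j * Q).coeff p x = delMul j Q.coeff p x := by
  change FPDO.mulCoeff _ _ p x = _
  unfold FPDO.mulCoeff delMul
  let F : Finset (ℤ × ℕ) := (Finset.range (j + 1)).image fun l => ((j : ℤ), l)
  rw [finsum_eq_sum_of_support_subset (s := F)]
  · rw [Finset.sum_image (by intro a _ b _ h; exact (Prod.ext_iff.1 h).2)]
    refine Finset.sum_congr rfl fun l _ => ?_
    rw [choose_natCast_int]
    simp [FPDO.del]
  · intro q hq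
    simp only [F, Finset.coe_image, Set.mem_image, Finset.coe_range, Set.mem_Iio]
    rw [Function.mem_support] at hq
    have h1 : q.1 = j := by
      by_contra h; apply hq; simp [FPDO.del, h]
    refine ⟨q.2, ?_, Prod.ext h1.symm rfl⟩
    by_contra h
    apply hq
    rw [h1, choose_natCast_int, Nat.choose_eq_zero_of_lt (by omega)]
    simp

theorem iteratedDeriv_sub_const_cast (y : ℝ) (l : ℕ) (x : ℝ) :
    iteratedDeriv l (fun ξ : ℝ => ((ξ - y : ℝ) : ℂ)) x =
      if l = 0 then ((x - y : ℝ) : ℂ) else if l = 1 then 1 else 0 := by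
  have h := congrFun (iteratedDeriv_eval_sub (X : ℂ[X]) y l) x
  simp only [eval_X] at h
  rw [h]
  rcases l with _ | _ | l
  · simp
  · simp
  · simp [Function.iterate_succ_apply]

theorem opD_coeff (N : ℕ) (y : ℝ) (p : ℤ) (x : ℝ) :
    (opD N y).coeff p x = if p = 1 - N then -((x - y : ℝ) : ℂ) else
      if p = -N then (N : ℂ) - 1 else 0 := by
  change -FPDO.mulCoeff _ _ p x = _
  unfold FPDO.mulCoeff
  let F : Finset (ℤ × ℕ) := {((1 - N : ℤ), (1 - N - p).toNat)}
  have hD : ∀ (i : ℤ) (l : ℕ), iteratedDeriv l ((FPDO.ofFun fun x => ((x - y : ℝ) : ℂ)).coeff i) x =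
      if i = 0 then (if l = 0 then ((x - y : ℝ) : ℂ) else if l = 1 then 1 else 0) else 0 := by
    intro i l
    by_cases h : i = 0
    · rw [if_pos h, ← iteratedDeriv_sub_const_cast]
      congr 1
      funext ξ
      simp [FPDO.ofFun, h]
    · rw [if_neg h]
      have : (FPDO.ofFun fun x => ((x - y : ℝ) : ℂ)).coeff i = fun _ => 0 := by
        funext ξ; simp [FPDO.ofFun, h]
      rw [this]; simp
  simp only [hD]
  rw [finsum_eq_sum_of_support_subset (s := F)]
  · simp only [F, Finset.sum_singleton]
    by_cases h1 : p = 1 - N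
    · simp [h1, FPDO.del]
    by_cases h2 : p = -N
    · have : (1 - N - p).toNat = 1 := by omega
      rw [if_neg h1, if_pos h2, this, if_pos (by rw [h2]; push_cast; ring)]
      simp [FPDO.del]
    · rw [if_neg h1, if_neg h2]
      by_cases h3 : p - (1 - N) + ((1 - N - p).toNat : ℤ) = 0
      · rw [if_pos h3, if_neg (by omega), if_neg (by omega)]; simp
      · rw [if_neg h3]; simp
  · intro q hq
    rw [Function.mem_support] at hq
    simp only [F, Finset.coe_singleton, Set.mem_singleton_iff]
    have h1 : q.1 = 1 - N := by
      by_contra h; apply hq; simp [FPDO.del, h]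
    have h2 : p - q.1 + q.2 = 0 := by
      by_contra h; apply hq; simp [h]
    exact Prod.ext h1 (by simp only; omega)

/-- As `D_N = -(x-y)∂^(1-N) + (N-1)∂^(-N)` has coefficients of degree at most one, only three index
pairs contribute. This is where the formula for `symD` comes from. -/
theorem mul_opD_coeff (N : ℕ) (y : ℝ) (Q : FPDO) (p : ℤ) (x : ℝ) :
    (Q * opD N y).coeff p x = -(((x - y : ℝ) : ℂ) * Q.coeff (p + N - 1) x +
      ((p : ℂ) + 1) * Q.coeff (p + N) x) := by
  change FPDO.mulCoeff _ _ p x = _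
  unfold FPDO.mulCoeff
  have hD : ∀ (i : ℤ) (l : ℕ), iteratedDeriv l ((opD N y).coeff i) x =
      if i = 1 - N then (if l = 0 then -((x - y : ℝ) : ℂ) else if l = 1 then -1 else 0) else
      if i = -N then (if l = 0 then (N : ℂ) - 1 else 0) else 0 := by
    intro i l
    have hf : (opD N y).coeff i = fun x => if i = 1 - N then -((x - y : ℝ) : ℂ) else
      if i = -N then (N : ℂ) - 1 else 0 := funext fun x => opD_coeff N y i x
    rw [hf]
    by_cases h : i = 1 - N
    · simp only [h, if_true]
      rw [iteratedDeriv_fun_neg, iteratedDeriv_sub_const_cast]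
      split_ifs <;> simp
    · simp only [h, if_false]
      by_cases h' : i = -N
      · simp only [h', if_true, iteratedDeriv_const]
      · simp [h']
  simp only [hD]
  let F : Finset (ℤ × ℕ) := {((p + N - 1 : ℤ), 0), ((p + N : ℤ), 1), ((p + N : ℤ), 0)}
  rw [finsum_eq_sum_of_support_subset (s := F)]
  · simp only [F]
    rw [Finset.sum_insert, Finset.sum_insert, Finset.sum_singleton]
    · simp only [Ring.choose_zero_right, Ring.choose_one_right]
      have c1 : p - (p + N - 1) + ((0 : ℕ) : ℤ) = 1 - N := by push_cast; ring
      have c2 : p - (p + N) + ((1 : ℕ) : ℤ) = 1 - N := by push_cast; ring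
      have c3 : p - (p + N) + ((0 : ℕ) : ℤ) = -N := by push_cast; ring
      have c4 : (-N : ℤ) ≠ 1 - N := by omega
      rw [c1, c2, c3]
      simp only [if_true, if_neg c4, one_ne_zero, if_false]
      push_cast
      ring
    · simp
    · simp
  · intro q hq
    rw [Function.mem_support] at hq
    obtain ⟨i, l⟩ := q
    have key : (p - i + l = 1 - N ∧ (l = 0 ∨ l = 1)) ∨ (p - i + l = -N ∧ l = 0) := by
      by_contra h
      apply hq
      push Not at h
      by_cases h1 : p - i + l = 1 - N
      · have := h.1 h1
        simp [h1, this.1, this.2]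
      · by_cases h2 : p - i + l = -N
        · have := h.2 h2
          rw [if_neg h1, if_pos h2, if_neg this, mul_zero]
        · rw [if_neg h1, if_neg h2, mul_zero]
    simp only [F, Finset.coe_insert, Finset.coe_singleton, Set.mem_insert_iff,
      Set.mem_singleton_iff, Prod.mk.injEq]
    omega

theorem opD_pow_coeff (N : ℕ) (y : ℝ) (k : ℕ) (p : ℤ) (x : ℝ) :
    (opD N y ^ k).coeff p x = (symPow N 0 k p).eval ((x - y : ℝ) : ℂ) := by
  induction k generalizing p with
  | zero =>
    change (FPDO.ofFun 1).coeff p x = _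
    rw [symPow_zero_right]
    simp only [FPDO.ofFun, symOne, Nat.cast_zero]
    split_ifs <;> simp
  | succ k ih =>
    change (opD N y ^ k * opD N y).coeff p x = _
    rw [mul_opD_coeff, ih, ih, symPow_succ_right, symD_apply]
    simp

theorem del_mul_opD_pow_coeff (N j k : ℕ) (y : ℝ) (p : ℤ) (x : ℝ) :
    (FPDO.del j * opD N y ^ k).coeff p x = (symPow N j k p).eval ((x - y : ℝ) : ℂ) := by
  rw [del_mul_coeff]
  have : (opD N y ^ k).coeff = fun p ξ => (symPow N 0 k p).eval ((ξ - y : ℝ) : ℂ) :=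
    funext fun p => funext fun x => opD_pow_coeff N y k p x
  rw [this, delMul_eval]
  rfl

end FPDOCoefficients

/-! ### Associativity of the product of formal pseudo-differential operators. -/

section MulCoeff

open FPDO Finset

/-- The order bounds confine the support to a finite box. The margins `lo` and `K` stay free so that
different products can be summed over a common box. -/
theorem mulCoeff_eq_sum {a b : ℤ → ℝ → ℂ} {m n p lo : ℤ} {K : ℕ} (ha : ∀ i, m < i → a i = 0)
    (hb : ∀ i, n < i → b i = 0) (hlo : lo ≤ p - n) (hK : m + n - p < K) (x : ℝ) :
    mulCoeff a b p x = ∑ i ∈ Icc lo m, ∑ l ∈ range K,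
      ((Ring.choose i l : ℤ) : ℂ) * a i x * iteratedDeriv l (b (p - i + l)) x := by
  unfold mulCoeff
  rw [finsum_eq_sum_of_support_subset (s := Icc lo m ×ˢ range K), sum_product]
  intro q hq
  rw [Function.mem_support] at hq
  have h1 : q.1 ≤ m := by
    by_contra h; apply hq; rw [ha _ (by omega)]; simp
  have h2 : p - q.1 + q.2 ≤ n := by
    by_contra h; apply hq; rw [hb _ (by omega)]; simp
  simp only [coe_product, Set.mem_prod, mem_coe, mem_Icc, mem_range]
  omega

theorem sum_antidiagonal_range {g : ℕ → ℕ → ℂ} {K : ℕ} (h : ∀ l b, K ≤ l + b → g l b = 0) :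
    ∑ r ∈ range K, ∑ q ∈ antidiagonal r, g q.1 q.2 = ∑ l ∈ range K, ∑ b ∈ range K, g l b := by
  rw [← sum_product' (f := g), ← sum_filter_of_ne (p := fun q : ℕ × ℕ => q.1 + q.2 < K)]
  · rw [← sum_fiberwise_of_maps_to (s := ({q ∈ range K ×ˢ range K | q.1 + q.2 < K}))
      (t := range K) (g := fun q : ℕ × ℕ => q.1 + q.2)]
    · refine sum_congr rfl fun r hr => sum_congr ?_ fun _ _ => rfl
      ext q
      simp only [HasAntidiagonal.mem_antidiagonal, mem_filter, mem_product, mem_range] at *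
      omega
    · intro q hq
      simpa using (mem_filter.1 hq).2
  · intro q _ hq
    by_contra hlt
    exact hq (h _ _ (by omega))

theorem sum_triple_regroup {g : ℕ → ℕ → ℕ → ℂ} {K : ℕ} (h : ∀ l b m, K ≤ l + b + m → g l b m = 0) :
    ∑ r ∈ range K, ∑ m ∈ range K, ∑ q ∈ antidiagonal r, g q.1 q.2 m =
      ∑ l ∈ range K, ∑ n ∈ range K, ∑ q ∈ antidiagonal n, g l q.1 q.2 := by
  have h1 : ∑ r ∈ range K, ∑ m ∈ range K, ∑ q ∈ antidiagonal r, g q.1 q.2 m =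
      ∑ m ∈ range K, ∑ l ∈ range K, ∑ b ∈ range K, g l b m := by
    rw [sum_comm]
    exact sum_congr rfl fun m _ =>
      sum_antidiagonal_range (g := fun l b => g l b m) fun l b hlb => h l b m (by omega)
  have h2 : ∀ l, ∑ n ∈ range K, ∑ q ∈ antidiagonal n, g l q.1 q.2 =
      ∑ b ∈ range K, ∑ m ∈ range K, g l b m := fun l =>
    sum_antidiagonal_range (g := fun b m => g l b m) fun b m hbm => h l b m (by omega)
  rw [h1, sum_congr rfl fun l _ => h2 l, sum_comm]
  exact sum_congr rfl fun l _ => sum_comm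

theorem choose_mul_choose_add (i : ℤ) (l b : ℕ) :
    Ring.choose i (l + b) * ((l + b).choose l : ℤ) = Ring.choose i l * Ring.choose (i - l) b := by
  have h := Ring.choose_smul_choose i (n := l + b) (k := l) (by omega)
  rw [nsmul_eq_mul, Nat.add_sub_cancel_left] at h
  rw [mul_comm]; exact_mod_cast h

theorem sum_Icc_shift {F : ℤ → ℂ} {a b a' b' d : ℤ}
    (h : ∀ j, F j ≠ 0 → a' ≤ j ∧ j ≤ b') (h' : ∀ j, F j ≠ 0 → a + d ≤ j ∧ j ≤ b + d) :
    ∑ i ∈ Icc a b, F (i + d) = ∑ j ∈ Icc a' b', F j := by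
  rw [← finsum_eq_sum_of_support_subset (s := Icc a' b') F,
    ← finsum_eq_sum_of_support_subset (s := Icc a b) fun i => F (i + d)]
  · exact finsum_comp_equiv (Equiv.addRight d)
  · intro i hi
    have := h' _ hi
    rw [coe_Icc, Set.mem_Icc]; omega
  · intro i hi
    rw [coe_Icc, Set.mem_Icc]; exact h _ hi

theorem contDiffAt_iteratedDeriv {f : ℝ → ℂ} {x : ℝ} (hf : ContDiffAt ℝ ∞ f x) (m : ℕ) :
    ContDiffAt ℝ ∞ (iteratedDeriv m f) x := by
  induction m with
  | zero => simpa using hf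
  | succ m ih =>
    rw [iteratedDeriv_succ]
    have h : ContDiffAt ℝ ∞ (fderiv ℝ (iteratedDeriv m f)) x := ih.fderiv_right (by simp)
    have h2 := h.clm_apply (contDiffAt_const (c := (1 : ℝ)))
    exact h2

theorem iteratedDeriv_iteratedDeriv (f : ℝ → ℂ) (b m : ℕ) :
    iteratedDeriv b (iteratedDeriv m f) = iteratedDeriv (b + m) f := by
  simp only [iteratedDeriv_eq_iterate, Function.iterate_add_apply]

theorem iteratedDeriv_mul_antidiagonal {f g : ℝ → ℂ} {x : ℝ} (hf : ContDiffAt ℝ ∞ f x)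
    (hg : ContDiffAt ℝ ∞ g x) (r : ℕ) :
    iteratedDeriv r (fun ξ => f ξ * g ξ) x = ∑ q ∈ antidiagonal r,
      (r.choose q.1 : ℂ) * iteratedDeriv q.1 f x * iteratedDeriv q.2 g x := by
  have h := iteratedDeriv_mul (n := r) (hf.of_le (by exact_mod_cast le_top))
    (hg.of_le (by exact_mod_cast le_top))
  rw [Finset.Nat.sum_antidiagonal_eq_sum_range_succ
    (f := fun i j => (r.choose i : ℂ) * iteratedDeriv i f x * iteratedDeriv j g x)]
  exact h

theorem iteratedDeriv_mulCoeff {b c : ℤ → ℝ → ℂ} {mb mc q lo : ℤ} {K : ℕ}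
    (hb : ∀ i, mb < i → b i = 0) (hc : ∀ i, mc < i → c i = 0) (hlo : lo ≤ q - mc)
    (hK : mb + mc - q < K) {x : ℝ} (hb' : ∀ i, ContDiffAt ℝ ∞ (b i) x)
    (hc' : ∀ i, ContDiffAt ℝ ∞ (c i) x) (r : ℕ) :
    iteratedDeriv r (mulCoeff b c q) x = ∑ j ∈ Icc lo mb, ∑ m ∈ range K,
      ((Ring.choose j m : ℤ) : ℂ) * ∑ s ∈ antidiagonal r, (r.choose s.1 : ℂ) *
        iteratedDeriv s.1 (b j) x * iteratedDeriv (s.2 + m) (c (q - j + m)) x := by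
  have hfun : mulCoeff b c q = fun ξ => ∑ j ∈ Icc lo mb, ∑ m ∈ range K,
      ((Ring.choose j m : ℤ) : ℂ) * (b j ξ * iteratedDeriv m (c (q - j + m)) ξ) := by
    funext ξ
    simp only [mulCoeff_eq_sum hb hc hlo hK ξ, mul_assoc]
  have hs : ∀ j m, ContDiffAt ℝ ∞ (fun ξ => ((Ring.choose j m : ℤ) : ℂ) *
      (b j ξ * iteratedDeriv m (c (q - j + m)) ξ)) x := fun j m =>
    contDiffAt_const.mul ((hb' j).mul (contDiffAt_iteratedDeriv (hc' _) m))
  rw [hfun, iteratedDeriv_fun_sum fun j _ => ContDiffAt.sum fun m _ =>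
    (hs j m).of_le (by exact_mod_cast le_top)]
  refine sum_congr rfl fun j _ => ?_
  rw [iteratedDeriv_fun_sum fun m _ => (hs j m).of_le (by exact_mod_cast le_top)]
  refine sum_congr rfl fun m _ => ?_
  rw [iteratedDeriv_const_mul_field, iteratedDeriv_mul_antidiagonal (hb' j)
    (contDiffAt_iteratedDeriv (hc' _) m)]
  simp only [iteratedDeriv_iteratedDeriv]

/-- Associativity of the product of formal pseudo-differential operators, at a point near which the
coefficients of the last two factors are smooth. -/
theorem mulCoeff_assoc {a b c : ℤ → ℝ → ℂ} {ma mb mc : ℤ}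
    (ha : ∀ i, ma < i → a i = 0) (hb : ∀ i, mb < i → b i = 0) (hc : ∀ i, mc < i → c i = 0)
    {x : ℝ} (hb' : ∀ i, ContDiffAt ℝ ∞ (b i) x) (hc' : ∀ i, ContDiffAt ℝ ∞ (c i) x) (p : ℤ) :
    mulCoeff (mulCoeff a b) c p x = mulCoeff a (mulCoeff b c) p x := by
  obtain ⟨K, hK⟩ : ∃ K : ℕ, ma + mb + mc - p < K := ⟨(ma + mb + mc - p).toNat + 1, by omega⟩
  set lo' : ℤ := p - mc with hlo'
  let lo : ℤ := min (p - mb - mc) (p - ma - mc)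
  have hlo1 : lo ≤ p - mb - mc := min_le_left _ _
  have hlo2 : lo ≤ p - ma - mc := min_le_right _ _
  -- Both bracketings are brought to a sum of `G`; only the right one requires differentiating a
  -- product.
  let G : ℤ → ℤ → ℕ → ℕ → ℂ := fun i j l n =>
    ((Ring.choose i l : ℤ) : ℂ) * ((Ring.choose (i - l + j) n : ℤ) : ℂ) * a i x *
      iteratedDeriv l (b j) x * iteratedDeriv n (c (p - i - j + l + n)) x
  have hL : mulCoeff (mulCoeff a b) c p x =
      ∑ i ∈ Icc lo ma, ∑ l ∈ range K, ∑ n ∈ range K, ∑ j ∈ Icc lo mb, G i j l n := by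
    rw [mulCoeff_eq_sum (K := K) (lo := lo') (mulCoeff_eq_zero ha hb) hc le_rfl hK]
    have h1 : ∀ i' ∈ Icc lo' (ma + mb), ∀ n ∈ range K,
        ((Ring.choose i' n : ℤ) : ℂ) * mulCoeff a b i' x * iteratedDeriv n (c (p - i' + n)) x =
        ∑ i ∈ Icc lo ma, ∑ l ∈ range K, G i (i' + (-i + l)) l n := by
      intro i' hi' n _
      rw [mem_Icc] at hi'
      rw [mulCoeff_eq_sum (K := K) (lo := lo) ha hb (by omega) (by omega), mul_sum, sum_mul]
      refine sum_congr rfl fun i _ => ?_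
      rw [mul_sum, sum_mul]
      refine sum_congr rfl fun l _ => ?_
      simp only [G]
      have e1 : i - l + (i' + (-i + l)) = i' := by ring
      have e2 : p - i - (i' + (-i + l)) + l + n = p - i' + n := by ring
      have e3 : i' - i + l = i' + (-i + l) := by ring
      rw [e1, e2, e3]; ring
    rw [sum_congr rfl fun i' hi' => sum_congr rfl (h1 i' hi')]
    rw [sum_congr rfl fun i' _ => sum_comm, sum_comm]
    refine sum_congr rfl fun i hi => ?_
    rw [sum_congr rfl fun i' _ => sum_comm, sum_comm]
    refine sum_congr rfl fun l _ => ?_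
    rw [sum_comm]
    refine sum_congr rfl fun n _ => ?_
    rw [mem_Icc] at hi
    have hsupp : ∀ j, G i j l n ≠ 0 → j ≤ mb ∧ p - i - j + l + n ≤ mc := by
      intro j hj
      constructor
      · by_contra h
        apply hj; simp only [G]; rw [hb j (by omega)]; simp
      · by_contra h
        apply hj; simp only [G]; rw [hc (p - i - j + l + n) (by omega)]; simp
    refine sum_Icc_shift (F := fun j => G i j l n) (fun j hj => ?_) (fun j hj => ?_) <;>
    · have := hsupp j hj
      omega
  have hR : mulCoeff a (mulCoeff b c) p x =
      ∑ i ∈ Icc lo ma, ∑ j ∈ Icc lo mb, ∑ l ∈ range K, ∑ n ∈ range K, G i j l n := by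
    rw [mulCoeff_eq_sum (K := K) (lo := lo) ha (mulCoeff_eq_zero hb hc) (by omega) (by omega)]
    refine sum_congr rfl fun i hi => ?_
    rw [mem_Icc] at hi
    let g : ℤ → ℕ → ℕ → ℕ → ℂ := fun j l b' m =>
      ((Ring.choose i l : ℤ) : ℂ) * (((Ring.choose (i - l) b' : ℤ) : ℂ) *
        ((Ring.choose j m : ℤ) : ℂ)) * a i x *
        iteratedDeriv l (b j) x * iteratedDeriv (b' + m) (c (p - i - j + l + ((b' + m : ℕ) : ℤ))) x
    have h1 : ∀ r ∈ range K, ((Ring.choose i r : ℤ) : ℂ) * a i x *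
        iteratedDeriv r (mulCoeff b c (p - i + r)) x =
        ∑ j ∈ Icc lo mb, ∑ m ∈ range K, ∑ s ∈ antidiagonal r, g j s.1 s.2 m := by
      intro r _
      rw [iteratedDeriv_mulCoeff (K := K) (lo := lo) hb hc (by omega) (by omega) hb' hc', mul_sum]
      refine sum_congr rfl fun j _ => ?_
      rw [mul_sum]
      refine sum_congr rfl fun m _ => ?_
      rw [mul_sum, mul_sum]
      refine sum_congr rfl fun s hs => ?_
      rw [HasAntidiagonal.mem_antidiagonal] at hs
      -- The binomial of the outer product times that of the Leibniz rule splits into one for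
      -- derivatives falling on `b` and one for those falling on `c`.
      have hc1 := choose_mul_choose_add i s.1 s.2
      rw [hs] at hc1
      have hc2 : ((Ring.choose i r : ℤ) : ℂ) * (r.choose s.1 : ℂ) =
          ((Ring.choose i s.1 : ℤ) : ℂ) * ((Ring.choose (i - s.1) s.2 : ℤ) : ℂ) := by
        exact_mod_cast congrArg (Int.cast (R := ℂ)) hc1
      have e : p - i - j + (s.1 : ℤ) + ((s.2 + m : ℕ) : ℤ) = p - i + r - j + m := by
        rw [← hs]; push_cast; ring
      simp only [g]
      rw [e]
      linear_combination a i x * ((Ring.choose j m : ℤ) : ℂ) * iteratedDeriv s.1 (b j) x *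
        iteratedDeriv (s.2 + m) (c (p - i + r - j + m)) x * hc2
    rw [sum_congr rfl h1, sum_comm]
    refine sum_congr rfl fun j hj => ?_
    rw [mem_Icc] at hj
    rw [sum_triple_regroup]
    · refine sum_congr rfl fun l _ => sum_congr rfl fun n _ => ?_
      simp only [G]
      -- Vandermonde: the `n` derivatives on `c` come partly from the outer product (upper index `i
      -- - l`) and partly from the inner one (upper index `j`).
      rw [Ring.add_choose_eq n (Commute.all (i - l : ℤ) j)]
      push_cast
      simp only [mul_sum, sum_mul]
      refine sum_congr rfl fun s hs => ?_
      rw [HasAntidiagonal.mem_antidiagonal] at hs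
      simp only [g]
      rw [hs]
    · intro l b' m h
      simp only [g]
      rw [hc (p - i - j + l + ((b' + m : ℕ) : ℤ)) (by push_cast; omega)]
      simp
  rw [hL, hR]
  refine sum_congr rfl fun i _ => ?_
  rw [sum_congr rfl fun l _ => sum_comm, sum_comm]

end MulCoeff

/-! ### The wave operator, its adjoint inverse, and the resolvent operator. -/

section WaveOperator

open FPDO Finset

/-- The coefficient of `∂^p` in `ℒ · ∑ X_q ∂^q`. -/
noncomputable def applyLSym (N : ℕ) (u : ℕ → ℝ → ℂ) (X : ℤ → ℝ → ℂ) (p : ℤ) (x : ℝ) : ℂ :=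
  delMul N X p x + ∑ i ∈ range (N - 1), u i x * delMul i X p x

theorem mulCoeff_congr_left {a a' b : ℤ → ℝ → ℂ} {x : ℝ} (h : ∀ i, a i x = a' i x) (p : ℤ) :
    mulCoeff a b p x = mulCoeff a' b p x := by
  simp only [mulCoeff, h]

theorem mulCoeff_congr_right {a b b' : ℤ → ℝ → ℂ} {x : ℝ} (h : ∀ i, b i =ᶠ[nhds x] b' i) (p : ℤ) :
    mulCoeff a b p x = mulCoeff a b' p x := by
  simp only [mulCoeff, fun i l => (h i).iteratedDeriv_eq l]

theorem mulCoeff_const_right (a : ℤ → ℝ → ℂ) (m p : ℤ) (x : ℝ) :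
    mulCoeff a (fun i _ => if i = m then 1 else 0) p x = a (p - m) x := by
  unfold mulCoeff
  rw [finsum_eq_single _ ((p - m, 0) : ℤ × ℕ)]
  · simp
  · intro q hq
    rw [iteratedDeriv_const]
    by_cases h : q.2 = 0
    · rw [if_pos h, if_neg, mul_zero]
      intro h'
      exact hq (Prod.ext (by simp only; omega) h)
    · rw [if_neg h, mul_zero]

theorem opL_mul_coeff (N : ℕ) (hN : 2 ≤ N) (u : ℕ → ℝ → ℂ) (Q : FPDO) (p : ℤ) (x : ℝ) :
    (opL N u * Q).coeff p x = applyLSym N u Q.coeff p x := by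
  change mulCoeff _ _ p x = _
  unfold mulCoeff
  have hinj : Set.InjOn (fun q : ℕ × ℕ => ((q.1 : ℤ), q.2))
      ↑(range (N + 1) ×ˢ range (N + 1)) := by
    rintro ⟨a, b⟩ _ ⟨c, d⟩ _ h
    simpa using h
  rw [finsum_eq_sum_of_support_subset (s := (range (N + 1) ×ˢ range (N + 1)).image
    fun q : ℕ × ℕ => ((q.1 : ℤ), q.2)), sum_image hinj, sum_product]
  · have h1 : ∀ i ∈ range (N + 1), ∑ l ∈ range (N + 1), ((Ring.choose (i : ℤ) l : ℤ) : ℂ) *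
        (opL N u).coeff i x * iteratedDeriv l (Q.coeff (p - i + l)) x =
        (opL N u).coeff i x * delMul i Q.coeff p x := by
      intro i hi
      rw [delMul, mul_sum]
      symm
      rw [sum_subset (range_mono (show i + 1 ≤ N + 1 by rw [mem_range] at hi; omega))]
      · refine sum_congr rfl fun l _ => ?_
        rw [choose_natCast_int]; ring
      · intro l _ hl
        rw [mem_range] at hl
        rw [Nat.choose_eq_zero_of_lt (by omega)]; simp
    rw [sum_congr rfl h1, sum_range_succ, show N = N - 1 + 1 by omega, sum_range_succ,
      ← show N = N - 1 + 1 by omega]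
    have h2 : (opL N u).coeff N x = 1 := by simp [opL]
    have h3 : (opL N u).coeff (N - 1 : ℕ) x = 0 := by
      simp only [opL]
      rw [if_neg (by omega), if_neg (by omega)]
    rw [h2, h3, applyLSym, zero_mul, add_zero, one_mul, add_comm]
    congr 1
    refine sum_congr rfl fun i hi => ?_
    rw [mem_range] at hi
    have h4 : (opL N u).coeff i x = u i x := by
      simp only [opL]
      rw [if_neg (by omega), if_pos (by omega)]; simp
    rw [h4]
  · rintro ⟨i, l⟩ hq
    rw [Function.mem_support] at hq
    have hi : 0 ≤ i ∧ i ≤ N := by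
      by_contra h
      apply hq
      have : (opL N u).coeff i x = 0 := by
        simp only [opL]
        rw [if_neg (by omega), if_neg (by omega)]
      simp [this]
    obtain ⟨i, rfl⟩ := Int.eq_ofNat_of_zero_le hi.1
    have hl : l ≤ i := by
      by_contra h
      apply hq
      simp only
      rw [choose_natCast_int, Nat.choose_eq_zero_of_lt (by omega)]; simp
    simp only [coe_image, Set.mem_image, mem_coe, mem_product, mem_range]
    exact ⟨(i, l), by simp only; omega, rfl⟩

theorem smoothOn_contDiffAt {P : FPDO} {I : Set ℝ} (hI : IsOpen I) (hP : P.SmoothOn I) {x : ℝ}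
    (hx : x ∈ I) (i : ℤ) : ContDiffAt ℝ ∞ (P.coeff i) x :=
  (hP i).contDiffAt (hI.mem_nhds hx)

/-- `ℒ S = S ∂^N` for a wave operator `S`. -/
theorem applyLSym_wave {N : ℕ} (hN : 2 ≤ N) {u : ℕ → ℝ → ℂ} {I : Set ℝ} (hI : IsOpen I) {S : FPDO}
    (hS : IsWaveOperator N u I S) (p : ℤ) {x : ℝ} (hx : x ∈ I) :
    applyLSym N u S.coeff p x = S.coeff (p - N) x := by
  obtain ⟨R, ⟨hR, _, hRS⟩, hL⟩ := hS.dressing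
  obtain ⟨mS, hmS⟩ := S.bdd
  obtain ⟨mR, hmR⟩ := R.bdd
  have hSN : ∀ q ξ, (S * FPDO.del N).coeff q ξ = S.coeff (q - N) ξ := fun q ξ =>
    mulCoeff_const_right S.coeff N q ξ
  obtain ⟨m1, hm1⟩ := (S * FPDO.del N).bdd
  rw [← opL_mul_coeff N hN u S p x]
  change mulCoeff _ _ p x = _
  -- `ℒ S = (S ∂^N R) S = (S ∂^N)(R S) = S ∂^N`.
  rw [mulCoeff_congr_left (a' := mulCoeff (S * FPDO.del N).coeff R.coeff) fun i => hL i x hx,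
    mulCoeff_assoc hm1 hmR hmS (smoothOn_contDiffAt hI hR hx) (smoothOn_contDiffAt hI hS.smooth hx),
    mulCoeff_congr_right (b' := fun i _ => if i = 0 then 1 else 0), mulCoeff_const_right, hSN,
    sub_zero]
  intro i
  filter_upwards [hI.mem_nhds hx] with ξ hξ
  refine (hRS i ξ hξ).trans ?_
  change (FPDO.ofFun 1).coeff i ξ = _
  simp [FPDO.ofFun]

theorem adjoint_coeff_eq_sum {S : FPDO} {m q : ℤ} {K : ℕ} (hm : ∀ i, m < i → S.coeff i = 0)
    (hK : m - q < K) (x : ℝ) :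
    S.adjoint.coeff q x = ∑ l ∈ range K, (-1 : ℂ) ^ (q + l) *
      ((Ring.choose (q + l) l : ℤ) : ℂ) * iteratedDeriv l (S.coeff (q + l)) x := by
  simp only [FPDO.adjoint]
  refine finsum_eq_sum_of_support_subset _ fun l hl => ?_
  rw [Function.mem_support] at hl
  rw [mem_coe, mem_range]
  by_contra h
  apply hl
  rw [hm _ (by omega)]; simp

/-- The coefficients of `T S^*` in terms of those of `T` and `S`. -/
theorem mul_adjoint_coeff {S T : FPDO} {mS mT p lo : ℤ} {K : ℕ}
    (hmS : ∀ i, mS < i → S.coeff i = 0) (hmT : ∀ i, mT < i → T.coeff i = 0)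
    (hlo : lo ≤ p - mS) (hK : mT + mS - p < K) {x : ℝ}
    (hS : ∀ i, ContDiffAt ℝ ∞ (S.coeff i) x) :
    (T * S.adjoint).coeff p x = ∑ i ∈ Icc lo mT, ∑ r ∈ range K, T.coeff i x *
      ((-1 : ℂ) ^ (p - i + r) * ((Ring.choose (p + r) r : ℤ) : ℂ) *
        iteratedDeriv r (S.coeff (p - i + r)) x) := by
  have hadj : ∀ i, mS < i → S.adjoint.coeff i = 0 := by
    intro i hi
    funext ξ
    rw [adjoint_coeff_eq_sum (K := 0) hmS (by push_cast; omega)]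
    simp
  change mulCoeff _ _ p x = _
  rw [mulCoeff_eq_sum hmT hadj hlo hK]
  refine sum_congr rfl fun i hi => ?_
  rw [mem_Icc] at hi
  let g : ℕ → ℕ → ℂ := fun l m => ((Ring.choose i l : ℤ) : ℂ) * T.coeff i x *
    ((-1 : ℂ) ^ (p - i + l + m) * ((Ring.choose (p - i + l + m) m : ℤ) : ℂ) *
      iteratedDeriv (l + m) (S.coeff (p - i + l + m)) x)
  have h1 : ∀ l ∈ range K, ((Ring.choose i l : ℤ) : ℂ) * T.coeff i x *
      iteratedDeriv l (S.adjoint.coeff (p - i + l)) x = ∑ m ∈ range K, g l m := by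
    intro l _
    have hfun : S.adjoint.coeff (p - i + l) = fun ξ => ∑ m ∈ range K, ((-1 : ℂ) ^ (p - i + l + m) *
        ((Ring.choose (p - i + l + m) m : ℤ) : ℂ)) *
        iteratedDeriv m (S.coeff (p - i + l + m)) ξ :=
      funext fun ξ => adjoint_coeff_eq_sum hmS (by omega) ξ
    rw [hfun, iteratedDeriv_fun_sum fun m _ => (contDiffAt_const.mul
      (contDiffAt_iteratedDeriv (hS _) m)).of_le (by exact_mod_cast le_top), mul_sum]
    refine sum_congr rfl fun m _ => ?_
    rw [iteratedDeriv_const_mul_field, iteratedDeriv_iteratedDeriv]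
  rw [sum_congr rfl h1, ← sum_antidiagonal_range]
  · refine sum_congr rfl fun r _ => ?_
    -- Vandermonde merges the binomials of the product with those of the adjoint, leaving a single
    -- derivative count `r`.
    have e : (p + r : ℤ) = i + (p - i + r) := by ring
    rw [e, Ring.add_choose_eq r (Commute.all i (p - i + r))]
    push_cast
    simp only [mul_sum, sum_mul]
    refine sum_congr rfl fun s hs => ?_
    rw [HasAntidiagonal.mem_antidiagonal] at hs
    simp only [g]
    have e2 : p - i + (s.1 : ℤ) + (s.2 : ℤ) = p - i + r := by rw [← hs]; push_cast; ring
    rw [e2, hs]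
    ring
  · intro l m h
    simp only [g]
    rw [hmS _ (by omega)]; simp

/-- At `p = -a - 1` the binomials of `mul_adjoint_coeff` become, up to sign, those of `∂^a`; so
coefficients of `T S*` can be read as residues of `∂^a` applied to `S`. -/
theorem choose_sub_succ (a r : ℕ) :
    ((Ring.choose (-(a : ℤ) - 1 + r) r : ℤ) : ℂ) = (-1) ^ r * (a.choose r : ℂ) := by
  have h := Ring.choose_neg ((a : ℤ) + 1 - r) r
  have e1 : -((a : ℤ) + 1 - r) = -(a : ℤ) - 1 + r := by ring
  have e2 : (a : ℤ) + 1 - r + r - 1 = a := by ring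
  rw [e1, e2, Ring.choose_natCast] at h
  rw [h, Units.smul_def, Int.coe_negOnePow_natCast]
  simp

variable {N : ℕ} {u : ℕ → ℝ → ℂ} {I : Set ℝ} {S T : FPDO}

theorem wave_coeff_eventually_zero (hI : IsOpen I) (hS : IsWaveOperator N u I S) {i : ℤ}
    (hi : 0 < i) {x : ℝ} (hx : x ∈ I) (l : ℕ) : iteratedDeriv l (S.coeff i) x = 0 := by
  have h : S.coeff i =ᶠ[nhds x] fun _ => 0 := by
    filter_upwards [hI.mem_nhds hx] with ξ hξ using hS.order i hi ξ hξ
  rw [h.iteratedDeriv_eq]; simp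

/-- Since `S* = 1 +` lower order on `I`, the highest coefficient of `T` is also that of `T S* = 1`.
The order of `T` is only bounded a priori, so `adjointInverse_coeff_pos` descends from that bound to
`0`. -/
theorem adjointInverse_coeff_top (hI : IsOpen I) (hS : IsWaveOperator N u I S)
    (hT : S.adjoint.IsInverseOn T I) {x : ℝ} (hx : x ∈ I) {p : ℤ}
    (ih : ∀ i, p < i → T.coeff i x = 0) : T.coeff p x = if p = 0 then 1 else 0 := by
  obtain ⟨mS, hmS⟩ := S.bdd
  obtain ⟨mT', hmT'⟩ := T.bdd
  set mT : ℤ := max mT' p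
  have hmT : ∀ i, mT < i → T.coeff i = 0 := fun i hi => hmT' i (by omega)
  obtain ⟨K, hK⟩ : ∃ K : ℕ, max (mT + mS - p) 0 < K :=
    ⟨(max (mT + mS - p) 0).toNat + 1, by omega⟩
  have h := mul_adjoint_coeff (p := p) (lo := min (p - mS) p) (K := K) hmS hmT
    (min_le_left _ _) (by omega) (smoothOn_contDiffAt hI hS.smooth hx)
  have h1 : (T * S.adjoint).coeff p x = if p = 0 then 1 else 0 := hT.2.2 p x hx
  rw [h1, sum_eq_single p, sum_eq_single 0] at h
  · simpa [hS.monic x hx] using h.symm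
  · intro r _ hr
    rw [wave_coeff_eventually_zero hI hS (by omega) hx]; simp
  · intro h0
    rw [mem_range] at h0; omega
  · intro i hi hip
    rw [mem_Icc] at hi
    rcases lt_or_gt_of_ne hip with hlt | hgt
    · refine sum_eq_zero fun r _ => ?_
      rw [wave_coeff_eventually_zero hI hS (by omega) hx]; simp
    · rw [ih i hgt]; simp
  · intro h0
    rw [mem_Icc] at h0; omega

theorem adjointInverse_coeff_pos (hI : IsOpen I) (hS : IsWaveOperator N u I S)
    (hT : S.adjoint.IsInverseOn T I) {x : ℝ} (hx : x ∈ I) {p : ℤ} (hp : 0 < p) :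
    T.coeff p x = 0 := by
  obtain ⟨mT, hmT⟩ := T.bdd
  induction hn : (mT - p).toNat using Nat.strong_induction_on generalizing p with
  | _ n ih =>
    by_cases hpm : mT < p
    · rw [hmT p hpm]; rfl
    rw [adjointInverse_coeff_top hI hS hT hx fun i hi => ?_, if_neg hp.ne']
    by_cases him : mT < i
    · rw [hmT i him]; rfl
    · exact ih (mT - i).toNat (by omega) (by omega) rfl

/-- This is the bilinear identity: the coefficient of `∂^(-a-1)` in `T S* = 1` is zero, and up to
sign it is the residue of `∂_x^a ∑_b ψ*_b(y) S ∂^{-b}` at `x = y`. -/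
theorem sum_adjointInverse_delMul (hI : IsOpen I) (hS : IsWaveOperator N u I S)
    (hT : S.adjoint.IsInverseOn T I) {x : ℝ} (hx : x ∈ I) (a : ℕ) :
    ∃ B₀ : ℕ, ∀ B ≥ B₀, ∑ b ∈ range (B + 1), ((-1) ^ b * T.coeff (-(b : ℤ)) x) *
      delMul a S.coeff (-1 + b) x = 0 := by
  obtain ⟨mS, hmS⟩ := S.bdd
  obtain ⟨mT', hmT'⟩ := T.bdd
  set mT : ℤ := max mT' 0
  have hmT : ∀ i, mT < i → T.coeff i = 0 := fun i hi => hmT' i (by omega)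
  -- Terms of `T` of order below `-a - 1 - mS` cannot reach `∂^(-a-1)` in `T S*`.
  refine ⟨(a + 1 + mS).toNat, fun B hB => ?_⟩
  obtain ⟨K, hK⟩ : ∃ K : ℕ, max (mT + mS - (-(a : ℤ) - 1)) a < K :=
    ⟨(max (mT + mS - (-(a : ℤ) - 1)) a).toNat + 1, by omega⟩
  have h := mul_adjoint_coeff (p := -(a : ℤ) - 1) (lo := -(B : ℤ)) (K := K) hmS hmT
    (by omega) (by omega) (smoothOn_contDiffAt hI hS.smooth hx)
  have h1 : (T * S.adjoint).coeff (-(a : ℤ) - 1) x = 0 := by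
    rw [hT.2.2 _ x hx]
    change (FPDO.ofFun 1).coeff _ x = 0
    simp only [FPDO.ofFun]
    rw [if_neg (by omega)]
  rw [h1] at h
  have h2 : ∀ i ∈ Icc (-(B : ℤ)) mT, ∑ r ∈ range K, T.coeff i x *
      ((-1 : ℂ) ^ (-(a : ℤ) - 1 - i + r) * ((Ring.choose (-(a : ℤ) - 1 + r) r : ℤ) : ℂ) *
        iteratedDeriv r (S.coeff (-(a : ℤ) - 1 - i + r)) x) =
      (-1 : ℂ) ^ (-(a : ℤ) - 1) * ((-1 : ℂ) ^ (-i) * T.coeff i x * delMul a S.coeff (-1 - i) x) := by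
    intro i _
    have hd : delMul a S.coeff (-1 - i) x = ∑ r ∈ range K, (a.choose r : ℂ) *
        iteratedDeriv r (S.coeff (-1 - i - a + r)) x := by
      rw [delMul]
      refine sum_subset (range_mono (by omega)) fun r _ hr => ?_
      rw [mem_range] at hr
      rw [Nat.choose_eq_zero_of_lt (by omega)]; simp
    rw [hd, mul_sum, mul_sum]
    refine sum_congr rfl fun r _ => ?_
    rw [choose_sub_succ, zpow_add₀ (by norm_num), zpow_sub₀ (by norm_num), zpow_natCast, zpow_neg]
    have e : -(a : ℤ) - 1 - i + r = -1 - i - a + r := by ring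
    have e2 : (-1 : ℂ) ^ r * (-1) ^ r = 1 := by rw [← pow_add, ← two_mul, pow_mul]; simp
    rw [e]
    linear_combination (T.coeff i x * ((-1 : ℂ) ^ (-(a : ℤ) - 1) / (-1) ^ i) * (a.choose r : ℂ) *
        iteratedDeriv r (S.coeff (-1 - i - a + r)) x) * e2
  rw [sum_congr rfl h2, ← mul_sum] at h
  have h3 := (mul_eq_zero.1 h.symm).resolve_left (zpow_ne_zero _ (by norm_num))
  rw [← h3]
  have himg : ∑ b ∈ range (B + 1), ((-1) ^ b * T.coeff (-(b : ℤ)) x) *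
      delMul a S.coeff (-1 + b) x = ∑ i ∈ (range (B + 1)).image (fun b : ℕ => -(b : ℤ)),
        (-1 : ℂ) ^ (-i) * T.coeff i x * delMul a S.coeff (-1 - i) x := by
    rw [sum_image (by intro a _ b _ h; simpa using h)]
    refine sum_congr rfl fun b _ => ?_
    rw [neg_neg, zpow_natCast, sub_neg_eq_add]
  rw [himg]
  refine sum_subset ?_ ?_
  · intro i hi
    obtain ⟨b, hb, rfl⟩ := mem_image.1 hi
    rw [mem_range] at hb
    rw [mem_Icc]; omega
  · intro i hi hi'
    rw [mem_Icc] at hi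
    have : 0 < i := by
      by_contra h0
      apply hi'
      refine mem_image.2 ⟨(-i).toNat, mem_range.2 (by omega), by omega⟩
    rw [adjointInverse_coeff_pos hI hS hT hx this]; simp

theorem delMul_congr {X Y : ℤ → ℝ → ℂ} {i : ℕ} {p : ℤ} {x : ℝ}
    (h : ∀ q ≥ p - i, X q =ᶠ[nhds x] Y q) : delMul i X p x = delMul i Y p x :=
  sum_congr rfl fun l _ => by rw [(h (p - i + l) (by omega)).iteratedDeriv_eq]

theorem delMul_sum {ι : Type*} (s : Finset ι) (c : ι → ℂ) (X : ι → ℤ → ℝ → ℂ) (i : ℕ) (p : ℤ)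
    {x : ℝ} (h : ∀ b ∈ s, ∀ q, ContDiffAt ℝ ∞ (X b q) x) :
    delMul i (fun q ξ => ∑ b ∈ s, c b * X b q ξ) p x = ∑ b ∈ s, c b * delMul i (X b) p x := by
  simp only [delMul, mul_sum]
  rw [sum_comm]
  refine sum_congr rfl fun l _ => ?_
  rw [iteratedDeriv_fun_sum fun b hb => (contDiffAt_const.mul (h b hb _)).of_le
    (by exact_mod_cast le_top), mul_sum]
  refine sum_congr rfl fun b _ => ?_
  rw [iteratedDeriv_const_mul_field]; ring

theorem delMul_shift (i : ℕ) (X : ℤ → ℝ → ℂ) (d p : ℤ) (x : ℝ) :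
    delMul i (fun q => X (q + d)) p x = delMul i X (p + d) x := by
  refine sum_congr rfl fun l _ => ?_
  have e : p - i + l + d = p + d - i + l := by ring
  simp only [e]

/-- Reads `∑ ω_n ∂^{-n}` as `∑_b ψ*_b(y) S ∂^{-b}`. Any cutoff `B ≥ -p` is exact because `S` has no
positive powers on `I`; a common cutoff serves several `p` at once. -/
theorem resolventOp_coeff (hS : IsWaveOperator N u I S) {w : ℕ → ℝ → ℝ → ℂ}
    (hw : ∀ n : ℕ, ∀ x ∈ I, ∀ y ∈ I, w n x y = resolventCoeff S T n x y) {x y : ℝ} (hx : x ∈ I)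
    (hy : y ∈ I) {B : ℕ} {p : ℤ} (hp : -(B : ℤ) ≤ p) :
    (resolventOp w y).coeff p x = ∑ b ∈ range (B + 1),
      ((-1) ^ b * T.coeff (-(b : ℤ)) y) * S.coeff (p + b) x := by
  simp only [resolventOp]
  by_cases h0 : p ≤ 0
  · obtain ⟨n, rfl⟩ : ∃ n : ℕ, p = -(n : ℤ) := ⟨(-p).toNat, by omega⟩
    rw [if_pos h0, neg_neg, Int.toNat_natCast, hw n x hx y hy, resolventCoeff,
      PowerSeries.coeff_mul, ← Finset.Nat.sum_antidiagonal_swap,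
      Finset.Nat.sum_antidiagonal_eq_sum_range_succ_mk]
    rw [← sum_subset (range_mono (show n + 1 ≤ B + 1 by omega))]
    · refine sum_congr rfl fun b hb => ?_
      rw [mem_range] at hb
      simp only [Prod.fst_swap, Prod.snd_swap, waveSeries, adjointWaveSeries, PowerSeries.coeff_mk]
      rw [mul_comm]
      congr 2
      push_cast [show b ≤ n by omega]; ring
    · intro b _ hb
      rw [mem_range] at hb
      rw [hS.order _ (by omega) x hx, mul_zero]
  · rw [if_neg h0]
    symm
    refine sum_eq_zero fun b _ => ?_
    rw [hS.order _ (by omega) x hx, mul_zero]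

theorem resolventOp_eventuallyEq (hI : IsOpen I) (hS : IsWaveOperator N u I S)
    {w : ℕ → ℝ → ℝ → ℂ}
    (hw : ∀ n : ℕ, ∀ x ∈ I, ∀ y ∈ I, w n x y = resolventCoeff S T n x y) {x y : ℝ} (hx : x ∈ I)
    (hy : y ∈ I) {B : ℕ} {p : ℤ} (hp : -(B : ℤ) ≤ p) :
    (resolventOp w y).coeff p =ᶠ[nhds x] fun ξ => ∑ b ∈ range (B + 1),
      ((-1) ^ b * T.coeff (-(b : ℤ)) y) * S.coeff (p + b) ξ := by
  filter_upwards [hI.mem_nhds hx] with ξ hξ using resolventOp_coeff hS hw hξ hy hp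

theorem contDiffAt_resolventOp (hI : IsOpen I) (hS : IsWaveOperator N u I S)
    {w : ℕ → ℝ → ℝ → ℂ}
    (hw : ∀ n : ℕ, ∀ x ∈ I, ∀ y ∈ I, w n x y = resolventCoeff S T n x y) {x y : ℝ} (hx : x ∈ I)
    (hy : y ∈ I) (p : ℤ) : ContDiffAt ℝ ∞ ((resolventOp w y).coeff p) x := by
  refine ContDiffAt.congr_of_eventuallyEq ?_
    (resolventOp_eventuallyEq (B := (-p).toNat) hI hS hw hx hy (by omega))
  exact ContDiffAt.sum fun b _ => contDiffAt_const.mul (smoothOn_contDiffAt hI hS.smooth hx _)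

theorem delMul_resolventOp (hI : IsOpen I) (hS : IsWaveOperator N u I S)
    {w : ℕ → ℝ → ℝ → ℂ}
    (hw : ∀ n : ℕ, ∀ x ∈ I, ∀ y ∈ I, w n x y = resolventCoeff S T n x y) {x y : ℝ} (hx : x ∈ I)
    (hy : y ∈ I) {i B : ℕ} {p : ℤ} (hp : -(B : ℤ) ≤ p - i) :
    delMul i (resolventOp w y).coeff p x = ∑ b ∈ range (B + 1),
      ((-1) ^ b * T.coeff (-(b : ℤ)) y) * delMul i S.coeff (p + b) x := by
  rw [delMul_congr fun q hq => resolventOp_eventuallyEq (B := B) hI hS hw hx hy (by omega),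
    delMul_sum (range (B + 1)) (fun b => (-1) ^ b * T.coeff (-(b : ℤ)) y)
      (fun b q => S.coeff (q + b)) i p fun b _ q => smoothOn_contDiffAt hI hS.smooth hx _]
  refine sum_congr rfl fun b _ => ?_
  rw [delMul_shift]

/-- The factors `ψ*_b(y)` are constants in `x` and `∂^{-b}` commutes with `∂^N`, so `ℒ S = S ∂^N`
passes to the sum. -/
theorem applyLSym_resolventOp (hN : 2 ≤ N) (hI : IsOpen I) (hS : IsWaveOperator N u I S)
    {w : ℕ → ℝ → ℝ → ℂ}
    (hw : ∀ n : ℕ, ∀ x ∈ I, ∀ y ∈ I, w n x y = resolventCoeff S T n x y) {x y : ℝ} (hx : x ∈ I)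
    (hy : y ∈ I) (p : ℤ) :
    applyLSym N u (resolventOp w y).coeff p x = (resolventOp w y).coeff (p - N) x := by
  obtain ⟨B, hB⟩ : ∃ B : ℕ, (N : ℤ) - p ≤ B := ⟨(N - p).toNat, by omega⟩
  rw [resolventOp_coeff hS hw hx hy (B := B) (by omega), applyLSym,
    delMul_resolventOp hI hS hw hx hy (B := B) (by omega)]
  have h1 : ∀ i ∈ range (N - 1), u i x * delMul i (resolventOp w y).coeff p x =
      ∑ b ∈ range (B + 1), ((-1) ^ b * T.coeff (-(b : ℤ)) y) *
        (u i x * delMul i S.coeff (p + b) x) := by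
    intro i hi
    rw [mem_range] at hi
    rw [delMul_resolventOp hI hS hw hx hy (B := B) (by omega), mul_sum]
    refine sum_congr rfl fun b _ => by ring
  rw [sum_congr rfl h1, sum_comm, ← sum_add_distrib]
  refine sum_congr rfl fun b _ => ?_
  rw [← mul_sum, ← mul_add]
  congr 1
  have := applyLSym_wave hN hI hS (p + b) hx
  rw [applyLSym] at this
  rw [this]
  congr 1; ring

theorem delMul_resolventOp_residue (hI : IsOpen I) (hS : IsWaveOperator N u I S)
    (hT : S.adjoint.IsInverseOn T I) {w : ℕ → ℝ → ℝ → ℂ}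
    (hw : ∀ n : ℕ, ∀ x ∈ I, ∀ y ∈ I, w n x y = resolventCoeff S T n x y) {y : ℝ}
    (hy : y ∈ I) (a : ℕ) : delMul a (resolventOp w y).coeff (-1) y = 0 := by
  obtain ⟨B₀, hB₀⟩ := sum_adjointInverse_delMul hI hS hT hy a
  rw [delMul_resolventOp hI hS hw hy hy (B := max B₀ (a + 1)) (by omega)]
  exact hB₀ _ (le_max_left _ _)

theorem resolventOp_coeff_zero (hI : IsOpen I) (hS : IsWaveOperator N u I S)
    (hT : S.adjoint.IsInverseOn T I) {w : ℕ → ℝ → ℝ → ℂ}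
    (hw : ∀ n : ℕ, ∀ x ∈ I, ∀ y ∈ I, w n x y = resolventCoeff S T n x y) {x y : ℝ} (hx : x ∈ I)
    (hy : y ∈ I) : (resolventOp w y).coeff 0 x = 1 := by
  have h0 : T.coeff 0 y = 1 := by
    rw [adjointInverse_coeff_top hI hS hT hy fun i hi => adjointInverse_coeff_pos hI hS hT hy hi,
      if_pos rfl]
  rw [resolventOp_coeff hS hw hx hy (B := 0) (by simp)]
  simp [h0, hS.monic x hx]

end WaveOperator

/-! ### Uniqueness for `ℒ E = E ∂^N` with vanishing residues. -/

section Uniqueness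

open Finset

theorem delMul_sub (X Y : ℤ → ℝ → ℂ) (i : ℕ) (p : ℤ) {x : ℝ}
    (hX : ∀ q, ContDiffAt ℝ ∞ (X q) x) (hY : ∀ q, ContDiffAt ℝ ∞ (Y q) x) :
    delMul i (fun q ξ => X q ξ - Y q ξ) p x = delMul i X p x - delMul i Y p x := by
  simp only [delMul]
  rw [← sum_sub_distrib]
  refine sum_congr rfl fun l _ => ?_
  have := iteratedDeriv_fun_sub (n := l) ((hX (p - i + l)).of_le (by exact_mod_cast le_top))
    ((hY (p - i + l)).of_le (by exact_mod_cast le_top))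
  rw [this]; ring

theorem applyLSym_sub (N : ℕ) (u : ℕ → ℝ → ℂ) (X Y : ℤ → ℝ → ℂ) (p : ℤ) {x : ℝ}
    (hX : ∀ q, ContDiffAt ℝ ∞ (X q) x) (hY : ∀ q, ContDiffAt ℝ ∞ (Y q) x) :
    applyLSym N u (fun q ξ => X q ξ - Y q ξ) p x = applyLSym N u X p x - applyLSym N u Y p x := by
  simp only [applyLSym, fun i => delMul_sub X Y i p hX hY, mul_sub, sum_sub_distrib]
  ring

/-- A solution of `ℒ E = E ∂^N` of negative order, such that all the residues of `∂^a E` vanish at `y`,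
is zero. -/
theorem symbol_eq_zero {N : ℕ} (hN : 2 ≤ N) {u : ℕ → ℝ → ℂ} {J : Set ℝ} (hJ : IsOpen J)
    (hJc : Convex ℝ J) {y : ℝ} (hy : y ∈ J) {E : ℤ → ℝ → ℂ}
    (hsm : ∀ p, ∀ x ∈ J, ContDiffAt ℝ ∞ (E p) x) (h0 : ∀ p ≥ 0, ∀ x ∈ J, E p x = 0)
    (hL : ∀ p, ∀ x ∈ J, applyLSym N u E p x = E (p - N) x)
    (hres : ∀ a, delMul a E (-1) y = 0) (p : ℤ) : ∀ x ∈ J, E p x = 0 := by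
  suffices h : ∀ n : ℕ, ∀ q ≥ -(n : ℤ), ∀ x ∈ J, E q x = 0 from h (-p).toNat p (by omega)
  intro n
  induction n with
  | zero => simpa using h0
  | succ n ih =>
    have hz : ∀ q ≥ -(n : ℤ), ∀ l : ℕ, ∀ x ∈ J, iteratedDeriv l (E q) x = 0 := by
      intro q hq l x hx
      have h : E q =ᶠ[nhds x] fun _ => 0 := by
        filter_upwards [hJ.mem_nhds hx] with ξ hξ using ih q hq ξ hξ
      rw [h.iteratedDeriv_eq]; simp
    have hder : ∀ x ∈ J, deriv (E (-(n : ℤ) - 1)) x = 0 := by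
      intro x hx
      -- In this coefficient both sides contain `E (-n-2)`, and the left also `N` times the
      -- derivative of `E (-n-1)`. As `ℒ` has no `∂^(N-1)` term, everything else involves only
      -- indices `≥ -n`.
      have h := hL ((N : ℤ) - n - 2) x hx
      have h1 : delMul N E ((N : ℤ) - n - 2) x =
          E (-(n : ℤ) - 2) x + N * deriv (E (-(n : ℤ) - 1)) x := by
        rw [delMul, sum_eq_add_of_mem 0 1 (by simp) (by simp; omega) zero_ne_one]
        · rw [iteratedDeriv_one, iteratedDeriv_zero, Nat.choose_one_right, Nat.choose_zero_right]
          have e1 : (N : ℤ) - n - 2 - N + (1 : ℕ) = -(n : ℤ) - 1 := by push_cast; ring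
          have e2 : (N : ℤ) - n - 2 - N + (0 : ℕ) = -(n : ℤ) - 2 := by push_cast; ring
          rw [e1, e2]; push_cast; ring
        · intro l _ hl
          rw [hz _ (by omega) l x hx, mul_zero]
      have h2 : ∑ i ∈ range (N - 1), u i x * delMul i E ((N : ℤ) - n - 2) x = 0 := by
        refine sum_eq_zero fun i hi => ?_
        rw [mem_range] at hi
        rw [delMul, sum_eq_zero, mul_zero]
        intro l _
        rw [hz _ (by omega) l x hx, mul_zero]
      have e3 : (N : ℤ) - n - 2 - N = -(n : ℤ) - 2 := by ring
      rw [applyLSym, h1, h2, e3, add_zero, add_eq_left] at h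
      exact (mul_eq_zero.1 h).resolve_left (by exact_mod_cast (by omega : N ≠ 0))
    -- The residue of `∂^n E` sees `E (-n-1)` undifferentiated and otherwise only coefficients
    -- already known to vanish.
    have hval : E (-(n : ℤ) - 1) y = 0 := by
      have h := hres n
      rw [delMul, sum_eq_single 0] at h
      · have e : -1 - (n : ℤ) + (0 : ℕ) = -(n : ℤ) - 1 := by push_cast; ring
        rw [e, Nat.choose_zero_right, iteratedDeriv_zero, Nat.cast_one, one_mul] at h
        exact h
      · intro l _ hl
        rw [hz _ (by omega) l y hy, mul_zero]
      · intro h'; simp at h'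
    intro q hq x hx
    rcases eq_or_lt_of_le hq with heq | hlt
    · have e : q = -(n : ℤ) - 1 := by rw [← heq]; push_cast; ring
      rw [e]
      have hdiff : ∀ ξ ∈ J, DifferentiableAt ℝ (E (-(n : ℤ) - 1)) ξ := fun ξ hξ =>
        (hsm _ ξ hξ).differentiableAt (by simp)
      have hb := hJc.norm_image_sub_le_of_norm_deriv_le (C := 0) hdiff
        (fun ξ hξ => by rw [hder ξ hξ]; simp) hy hx
      rw [hval, sub_zero, zero_mul] at hb
      exact norm_le_zero_iff.1 hb
    · exact ih q (by push_cast at hlt; omega) x hx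

end Uniqueness

/-! ### The Leibniz rule for `∂^i` times a function times an operator. -/

section Leibniz

open Finset Polynomial

theorem delMul_mul_eval (i : ℕ) (h : ℝ → ℂ) (q : ℤ → ℂ[X]) (y : ℝ) (p : ℤ) {x : ℝ}
    (hh : ContDiffAt ℝ ∞ h x) :
    delMul i (fun p ξ => h ξ * (q p).eval ((ξ - y : ℝ) : ℂ)) p x =
      ∑ s ∈ antidiagonal i, (i.choose s.1 : ℂ) * iteratedDeriv s.1 h x *
        ((symDel ^ s.2) q p).eval ((x - y : ℝ) : ℂ) := by
  let g : ℕ → ℕ → ℂ := fun a b => (i.choose (a + b) : ℂ) * (((a + b).choose a : ℂ) *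
    iteratedDeriv a h x * (derivative^[b] (q (p - i + (a + b : ℕ)))).eval ((x - y : ℝ) : ℂ))
  have h1 : delMul i (fun p ξ => h ξ * (q p).eval ((ξ - y : ℝ) : ℂ)) p x =
      ∑ l ∈ range (i + 1), ∑ s ∈ antidiagonal l, g s.1 s.2 := by
    refine sum_congr rfl fun l _ => ?_
    rw [iteratedDeriv_mul_antidiagonal hh (contDiff_eval_sub _ y).contDiffAt, mul_sum]
    refine sum_congr rfl fun s hs => ?_
    rw [HasAntidiagonal.mem_antidiagonal] at hs
    simp only [g, hs, iteratedDeriv_eval_sub]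
  rw [h1, sum_antidiagonal_range, Finset.Nat.sum_antidiagonal_eq_sum_range_succ
    (f := fun a m => (i.choose a : ℂ) * iteratedDeriv a h x *
        ((symDel ^ m) q p).eval ((x - y : ℝ) : ℂ))]
  · refine sum_congr rfl fun a ha => ?_
    rw [mem_range] at ha
    rw [symDel_pow_apply, eval_finsetSum, mul_sum]
    rw [← sum_subset (range_mono (show i - a + 1 ≤ i + 1 by omega))]
    · refine sum_congr rfl fun b hb => ?_
      rw [mem_range] at hb
      have hc : (i.choose (a + b) : ℂ) * ((a + b).choose a : ℂ) =
          (i.choose a : ℂ) * ((i - a).choose b : ℂ) := by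
        have := Nat.choose_mul (n := i) (k := a + b) (s := a) (by omega)
        rw [Nat.add_sub_cancel_left] at this
        exact_mod_cast this
      have e : p - i + (a + b : ℕ) = p - ((i - a : ℕ) : ℤ) + b := by
        push_cast [show a ≤ i by omega]; ring
      simp only [g, e, eval_mul, eval_C]
      linear_combination iteratedDeriv a h x *
        (derivative^[b] (q (p - ((i - a : ℕ) : ℤ) + b))).eval ((x - y : ℝ) : ℂ) * hc
    · intro b _ hb
      rw [mem_range] at hb
      simp only [g]
      rw [Nat.choose_eq_zero_of_lt (show i < a + b by omega)]; simp
  · intro a b hab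
    simp only [g]
    rw [Nat.choose_eq_zero_of_lt (show i < a + b by omega)]; simp

end Leibniz

/-! ### Reduction of the heat equation to the terms with `j ≤ N - 2`. -/

section SpanReduction

open Finset

variable {E : Type*} [AddCommGroup E] [Module ℂ E]

/-- The `(k, j)`-term of `(∂_t - κ ℒ)` applied to `∑ g ∂^j t^k`, expressed through the `e j k = ∂^j t^k`;
here `g l` is the `l`-th derivative of the coefficient, and `v i` the value of `u_i`. -/
noncomputable def heatTerm (N : ℕ) (κ : ℂ) (v : ℕ → ℂ) (g : ℕ → ℂ) (e : ℕ → ℕ → E) (k j : ℕ) : E :=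
  ((k : ℂ) * g 0) • e j (k - 1) + (κ * g 0) • e (j + N) k -
    κ • ((∑ s ∈ antidiagonal N, ((N.choose s.1 : ℂ) * g s.1) • e (j + s.2) k) +
      ∑ i ∈ range (N - 1), v i • ∑ s ∈ antidiagonal i,
        ((i.choose s.1 : ℂ) * g s.1) • e (j + s.2) k)

/-- The term `e (j + N) k` cancels between `∂_t` and `κ ∂^N`. What remains has first index at most
`2N - 3`, so one use of `hrel` suffices. For `k = 0` that relation is unavailable, but `hg` then
leaves only the undifferentiated term with `j = 0`. The module `E` is general so that functions and
symbols can be treated together. -/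
theorem heatTerm_mem_span {N M : ℕ} (hN : 2 ≤ N) (κ : ℂ) (v : ℕ → ℂ) {g : ℕ → ℂ} {e : ℕ → ℕ → E}
    {α : ℂ} {β : ℕ → ℂ}
    (hrel : ∀ m k, e (N - 1 + m) (k + 1) = α • e m k + β m • e (m - 1) k) {k j : ℕ} (hk : k ≤ M)
    (hj : j < N - 1) (hg : k = 0 → ∀ l, (l ≠ 0 ∨ j ≠ 0) → g l = 0) :
    heatTerm N κ v g e k j ∈ Submodule.span ℂ ((fun q : ℕ × ℕ => e q.2 q.1) ''
      ↑(range (M + 1) ×ˢ range (N - 1))) := by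
  set W := Submodule.span ℂ ((fun q : ℕ × ℕ => e q.2 q.1) '' ↑(range (M + 1) ×ˢ range (N - 1)))
  have hbase : ∀ k ≤ M, ∀ j < N - 1, e j k ∈ W := fun k hk j hj =>
    Submodule.subset_span ⟨(k, j), by simp; omega, rfl⟩
  have hred : ∀ k, k + 1 ≤ M → ∀ m < N - 1 + (N - 1), e m (k + 1) ∈ W := by
    intro k hk m hm
    by_cases h : m < N - 1
    · exact hbase _ hk _ h
    · obtain ⟨m, rfl⟩ := Nat.exists_eq_add_of_le (not_lt.1 h)
      rw [hrel]
      exact W.add_mem (W.smul_mem _ (hbase _ (by omega) _ (by omega)))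
        (W.smul_mem _ (hbase _ (by omega) _ (by omega)))
  have hmem : ∀ (c : ℂ) (s1 s2 : ℕ), (s2 < N - 1 ∨ (s2 ≤ N - 1 ∧ s1 ≠ 0)) →
      (c * g s1) • e (j + s2) k ∈ W := by
    intro c s1 s2 hs
    rcases k with _ | k
    · by_cases h : s1 ≠ 0 ∨ j ≠ 0
      · rw [hg rfl s1 h]; simp
      · push Not at h
        rw [h.2]
        exact W.smul_mem _ (hbase _ (by omega) _ (by omega))
    · exact W.smul_mem _ (hred k hk _ (by omega))
  have h1 : ((k : ℂ) * g 0) • e j (k - 1) ∈ W := W.smul_mem _ (hbase _ (by omega) _ hj)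
  have h2 : ∑ i ∈ range (N - 1), v i • ∑ s ∈ antidiagonal i,
      ((i.choose s.1 : ℂ) * g s.1) • e (j + s.2) k ∈ W := by
    refine W.sum_mem fun i hi => W.smul_mem _ (W.sum_mem fun s hs => hmem _ _ _ ?_)
    rw [mem_range] at hi
    rw [HasAntidiagonal.mem_antidiagonal] at hs
    omega
  have h3 : (∑ s ∈ antidiagonal N, ((N.choose s.1 : ℂ) * g s.1) • e (j + s.2) k) -
      g 0 • e (j + N) k ∈ W := by
    have h0 : ((0, N) : ℕ × ℕ) ∈ antidiagonal N := by simp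
    have : g 0 • e (j + N) k = ((N.choose ((0, N) : ℕ × ℕ).1 : ℂ) * g ((0, N) : ℕ × ℕ).1) •
      e (j + ((0, N) : ℕ × ℕ).2) k := by simp
    rw [this, ← sum_erase_eq_sub h0]
    refine W.sum_mem fun s hs => hmem _ _ _ ?_
    rw [mem_erase, HasAntidiagonal.mem_antidiagonal] at hs
    right
    have : s.1 ≠ 0 := by
      intro h
      exact hs.1 (Prod.ext h (by simp only; omega))
    omega
  have h4 : heatTerm N κ v g e k j = ((k : ℂ) * g 0) • e j (k - 1) -
      κ • (((∑ s ∈ antidiagonal N, ((N.choose s.1 : ℂ) * g s.1) • e (j + s.2) k) -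
      g 0 • e (j + N) k) + ∑ i ∈ range (N - 1), v i • ∑ s ∈ antidiagonal i,
        ((i.choose s.1 : ℂ) * g s.1) • e (j + s.2) k) := by
    rw [heatTerm]
    module
  rw [h4]
  exact W.sub_mem h1 (W.smul_mem _ (W.add_mem h3 h2))

end SpanReduction

/-! ### The heat operator satisfies `ℒ H = H ∂^N` and the residue condition. -/

section HeatOperator

open Finset Polynomial

/-- The coefficient of `t^k ∂^j` in the heat kernel expansion, including the leading term. -/
noncomputable def heatCoeff (H : ℕ → ℕ → ℝ → ℝ → ℂ) (y : ℝ) (k j : ℕ) (ξ : ℝ) : ℂ :=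
  if k = 0 then (if j = 0 then 1 else 0) else H k j ξ y

/-- The coefficient of `∂^p` in `(κ/N)^k ∂^j D_N^k`. -/
noncomputable def symE (N : ℕ) (κ : ℝ) (y : ℝ) (j k : ℕ) (p : ℤ) (ξ : ℝ) : ℂ :=
  ((κ : ℂ) / N) ^ k * (symPow N j k p).eval ((ξ - y : ℝ) : ℂ)

/-- The coefficient of `∂^p` in `H(x, y, ∂)` truncated after the terms with `D_N^M`. -/
noncomputable def heatSymTrunc (N : ℕ) (κ : ℝ) (H : ℕ → ℕ → ℝ → ℝ → ℂ) (y : ℝ) (M : ℕ) (p : ℤ)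
    (ξ : ℝ) : ℂ :=
  ∑ q ∈ range (M + 1) ×ˢ range (N - 1), heatCoeff H y q.1 q.2 ξ * symE N κ y q.2 q.1 p ξ

variable {N : ℕ} {κ : ℝ} {u : ℕ → ℝ → ℂ} {I : Set ℝ} {U : Set (ℝ × ℝ)} {H : ℕ → ℕ → ℝ → ℝ → ℂ}

theorem sum_heatCoeff_zero (hN : 2 ≤ N) (y : ℝ) (f : ℕ → ℂ) (ξ : ℝ) :
    ∑ j ∈ range (N - 1), heatCoeff H y 0 j ξ * f j = f 0 := by
  rw [sum_eq_single 0]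
  · simp [heatCoeff]
  · intro j _ hj; simp [heatCoeff, hj]
  · intro h; rw [mem_range] at h; omega

theorem symE_order {j k M : ℕ} {p : ℤ} (hN : 2 ≤ N) (hj : j < N - 1) (hk : M < k)
    (hp : -(M : ℤ) ≤ p) (y ξ : ℝ) : symE N κ y j k p ξ = 0 := by
  rw [symE, symPow_order, eval_zero, mul_zero]
  have h1 : (j : ℤ) + 2 ≤ N := by omega
  have h2 : (M : ℤ) + 1 ≤ k := by omega
  have h3 : (2 : ℤ) ≤ N := by omega
  nlinarith

theorem heatOp_coeff_eq_trunc (hN : 2 ≤ N) {M : ℕ} {p : ℤ} (hp : -(M : ℤ) ≤ p) (y ξ : ℝ) :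
    (heatOp N κ H y).coeff p ξ = heatSymTrunc N κ H y M p ξ := by
  have h1 : ∀ j ∈ range (N - 1), (∑ᶠ k : ℕ, if 1 ≤ k then
      H k j ξ y * ((κ : ℂ) / N) ^ k * (FPDO.del j * opD N y ^ k).coeff p ξ else 0) =
      ∑ k ∈ range M, heatCoeff H y (k + 1) j ξ * symE N κ y j (k + 1) p ξ := by
    intro j hj
    rw [mem_range] at hj
    rw [finsum_eq_sum_of_support_subset (s := range (M + 1)), sum_range_succ']
    · rw [if_neg (by omega), add_zero]
      refine sum_congr rfl fun k _ => ?_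
      rw [if_pos (by omega), del_mul_opD_pow_coeff, heatCoeff, if_neg (by omega), symE]
      ring
    · intro k hk
      rw [Function.mem_support] at hk
      rw [mem_coe, mem_range]
      by_contra h
      apply hk
      -- The vanishing does not involve the sign; taking it to be `1` makes the prefactor visibly
      -- nonzero and cancellable.
      have := symE_order (κ := 1) hN hj (show M < k by omega) hp y ξ
      rw [symE] at this
      rw [del_mul_opD_pow_coeff,
        (mul_eq_zero.1 this).resolve_left (pow_ne_zero _ (by simp; omega))]
      simp
  change (1 : FPDO).coeff p ξ + _ = _
  rw [sum_congr rfl h1, heatSymTrunc, sum_product, sum_range_succ', sum_comm,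
    sum_heatCoeff_zero hN y (fun j => symE N κ y j 0 p ξ), add_comm]
  congr 1
  change (if p = 0 then (1 : ℝ → ℂ) ξ else 0) = _
  rw [symE, symPow_zero_right, symOne]
  push_cast
  split_ifs <;> simp

theorem contDiffAt_heatCoeff (hH : IsHadamard N κ u I U H) {x y : ℝ} (hxy : (x, y) ∈ U) (k : ℕ)
    {j : ℕ} (hj : j < N - 1) : ContDiffAt ℝ ∞ (heatCoeff H y k j) x := by
  by_cases hk : k = 0
  · have : heatCoeff H y k j = fun _ => if j = 0 then 1 else 0 := by
      funext ξ; simp [heatCoeff, hk]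
    rw [this]; exact contDiffAt_const
  · have : heatCoeff H y k j = (fun p : ℝ × ℝ => H k j p.1 p.2) ∘ fun ξ => (ξ, y) := by
      funext ξ; simp [heatCoeff, hk]
    rw [this]
    exact ((hH.smooth k j (by omega) hj).contDiffAt (hH.isOpen.mem_nhds hxy)).comp x
      (by fun_prop)

theorem contDiff_symE (y : ℝ) (j k : ℕ) (p : ℤ) : ContDiff ℝ ∞ (symE N κ y j k p) :=
  contDiff_const.mul (contDiff_eval_sub _ y)

theorem contDiffAt_heatOp (hN : 2 ≤ N) (hH : IsHadamard N κ u I U H) {x y : ℝ} (hxy : (x, y) ∈ U)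
    (p : ℤ) : ContDiffAt ℝ ∞ ((heatOp N κ H y).coeff p) x := by
  have : (heatOp N κ H y).coeff p = heatSymTrunc N κ H y (-p).toNat p :=
    funext fun ξ => heatOp_coeff_eq_trunc hN (by omega) y ξ
  rw [this]
  refine ContDiffAt.sum fun q hq => ?_
  simp only [mem_product, mem_range] at hq
  exact (contDiffAt_heatCoeff hH hxy _ hq.2).mul (contDiff_symE y _ _ _).contDiffAt

theorem delMul_heatSymTrunc (hH : IsHadamard N κ u I U H) {x y : ℝ} (hxy : (x, y) ∈ U) (M i : ℕ)
    (p : ℤ) :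
    delMul i (heatSymTrunc N κ H y M) p x = ∑ q ∈ range (M + 1) ×ˢ range (N - 1),
      ∑ s ∈ antidiagonal i, ((i.choose s.1 : ℂ) * iteratedDeriv s.1 (heatCoeff H y q.1 q.2) x) *
        symE N κ y (q.2 + s.2) q.1 p x := by
  have hfun : heatSymTrunc N κ H y M = fun p ξ => ∑ q ∈ range (M + 1) ×ˢ range (N - 1),
      ((κ : ℂ) / N) ^ q.1 * (heatCoeff H y q.1 q.2 ξ *
        (symPow N q.2 q.1 p).eval ((ξ - y : ℝ) : ℂ)) := by
    funext p ξ
    refine sum_congr rfl fun q _ => ?_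
    rw [symE]; ring
  rw [hfun, delMul_sum _ (fun q : ℕ × ℕ => ((κ : ℂ) / N) ^ q.1)
    (fun q p ξ => heatCoeff H y q.1 q.2 ξ * (symPow N q.2 q.1 p).eval ((ξ - y : ℝ) : ℂ))]
  · refine sum_congr rfl fun q hq => ?_
    simp only [mem_product, mem_range] at hq
    rw [delMul_mul_eval i _ _ y p (contDiffAt_heatCoeff hH hxy _ hq.2), mul_sum]
    refine sum_congr rfl fun s _ => ?_
    have : (symDel ^ s.2) (symPow N q.2 q.1) = symPow N (q.2 + s.2) q.1 := by
      rw [symPow, symPow, ← Module.End.mul_apply, ← pow_add, add_comm]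
    rw [this, symE]; ring
  · intro q hq p
    simp only [mem_product, mem_range] at hq
    exact (contDiffAt_heatCoeff hH hxy _ hq.2).mul (contDiff_eval_sub _ y).contDiffAt

/-- The normalisation `(κ/N)^k` together with `κ² = 1` turns the factor `N k` of `symPow_shift` into
the `k` of `∂_t t^k`. -/
theorem symE_shift (hN : 2 ≤ N) (hκ : IsHeatSign N κ) (y : ℝ) (j k : ℕ) (p : ℤ) (ξ : ℝ) :
    κ * symE N κ y j k (p - N) ξ =
      k * symE N κ y j (k - 1) p ξ + κ * symE N κ y (j + N) k p ξ := by
  have hκ2 : (κ : ℂ) ^ 2 = 1 := by exact_mod_cast isHeatSign_sq_eq_one hκ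
  have hNC : (N : ℂ) ≠ 0 := by exact_mod_cast (by omega : N ≠ 0)
  simp only [symE]
  rw [symPow_shift]
  simp only [eval_add, eval_mul, eval_C]
  rcases k with _ | k
  · simp
  · rw [Nat.add_sub_cancel, pow_succ]
    push_cast
    field_simp
    linear_combination ((κ : ℂ) / N) ^ k * N * ((k : ℂ) + 1) *
      (symPow N j k p).eval ((ξ : ℂ) - y) * hκ2

theorem symE_reduce (hN : 2 ≤ N) (y : ℝ) (m k : ℕ) (p : ℤ) (ξ : ℝ) :
    symE N κ y (N - 1 + m) (k + 1) p ξ = (-((κ : ℂ) / N) * (ξ - y : ℝ)) * symE N κ y m k p ξ +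
      (-((κ : ℂ) / N) * m) * symE N κ y (m - 1) k p ξ := by
  simp only [symE]
  rw [symPow_reduce N m k (by omega)]
  simp only [eval_neg, eval_add, eval_mul, eval_C, eval_X]
  ring

/-- By `symE_shift`, on symbols `∂_t` is right multiplication by `κ ∂^N`; compare
`sum_heatTerm_airy`, the same expression evaluated on functions. -/
theorem sum_heatTerm_symE (hN : 2 ≤ N) (hκ : IsHeatSign N κ) (hH : IsHadamard N κ u I U H) {x y : ℝ}
    (hxy : (x, y) ∈ U) (M : ℕ) (p : ℤ) :
    ∑ q ∈ range (M + 1) ×ˢ range (N - 1), heatTerm N (κ : ℂ) (fun i => u i x)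
      (fun l => iteratedDeriv l (heatCoeff H y q.1 q.2) x) (fun j k => symE N κ y j k p x) q.1 q.2 =
    κ * (heatSymTrunc N κ H y M (p - N) x - applyLSym N u (heatSymTrunc N κ H y M) p x) := by
  rw [applyLSym]
  simp only [delMul_heatSymTrunc hH hxy, heatSymTrunc, mul_sum]
  rw [sum_comm (s := range (N - 1)), ← sum_add_distrib, ← sum_sub_distrib, mul_sum]
  refine sum_congr rfl fun q _ => ?_
  simp only [heatTerm, smul_eq_mul, iteratedDeriv_zero, mul_sum]
  simp only [← mul_sum]
  linear_combination (-heatCoeff H y q.1 q.2 x) * symE_shift hN hκ y q.2 q.1 p x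

theorem heatKernelTrunc_eq (hN : 2 ≤ N) (M : ℕ) (ξ y t : ℝ) :
    heatKernelTrunc N κ H M ξ y t = ∑ q ∈ range (M + 1) ×ˢ range (N - 1),
      heatCoeff H y q.1 q.2 ξ * ((t : ℂ) ^ q.1 * airyTerm N κ q.2 ξ y t) := by
  rw [sum_product, sum_range_succ',
    sum_heatCoeff_zero hN y (fun j => (t : ℂ) ^ 0 * airyTerm N κ j ξ y t), heatKernelTrunc,
    pow_zero, one_mul, add_comm, sum_comm]
  congr 1
  refine sum_congr rfl fun j _ => ?_
  rw [mul_sum, range_eq_Ico, sum_Ico_add' (fun k => heatCoeff H y k j ξ *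
    ((t : ℂ) ^ k * airyTerm N κ j ξ y t)) 0 M 1]
  refine sum_congr (by ext; simp) fun k hk => ?_
  rw [mem_Ico] at hk
  rw [heatCoeff, if_neg (by omega)]; ring

theorem iteratedDeriv_heatKernelTrunc (hN : 2 ≤ N) (hκ : IsHeatSign N κ) (hH : IsHadamard N κ u I U H)
    {x y : ℝ} (hxy : (x, y) ∈ U) (M i : ℕ) {t : ℝ} (ht : 0 < t) :
    iteratedDeriv i (fun ξ => heatKernelTrunc N κ H M ξ y t) x =
      ∑ q ∈ range (M + 1) ×ˢ range (N - 1), ∑ s ∈ antidiagonal i,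
        ((i.choose s.1 : ℂ) * iteratedDeriv s.1 (heatCoeff H y q.1 q.2) x) *
          ((t : ℂ) ^ q.1 * airyTerm N κ (q.2 + s.2) x y t) := by
  have ha : ∀ k j, ContDiffAt ℝ ∞ (fun ξ => (t : ℂ) ^ k * airyTerm N κ j ξ y t) x := fun k j =>
    contDiffAt_const.mul (contDiff_airyTerm hN hκ j y ht).contDiffAt
  simp only [heatKernelTrunc_eq hN]
  rw [iteratedDeriv_fun_sum]
  · refine sum_congr rfl fun q hq => ?_
    simp only [mem_product, mem_range] at hq
    rw [iteratedDeriv_mul_antidiagonal (contDiffAt_heatCoeff hH hxy _ hq.2) (ha _ _)]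
    refine sum_congr rfl fun s _ => ?_
    rw [iteratedDeriv_const_mul_field, iteratedDeriv_airyTerm hN hκ _ _ y ht]
  · intro q hq
    simp only [mem_product, mem_range] at hq
    exact ((contDiffAt_heatCoeff hH hxy _ hq.2).mul (ha _ _)).of_le (by exact_mod_cast le_top)

theorem hasDerivAt_heatKernelTrunc (hN : 2 ≤ N) (hκ : IsHeatSign N κ) (M : ℕ) (x y : ℝ) {t : ℝ}
    (ht : 0 < t) :
    HasDerivAt (fun τ => heatKernelTrunc N κ H M x y τ)
      (∑ q ∈ range (M + 1) ×ˢ range (N - 1), heatCoeff H y q.1 q.2 x *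
        (q.1 * ((t : ℂ) ^ (q.1 - 1) * airyTerm N κ q.2 x y t) +
          κ * ((t : ℂ) ^ q.1 * airyTerm N κ (q.2 + N) x y t))) t := by
  simp only [heatKernelTrunc_eq hN]
  refine HasDerivAt.fun_sum fun q _ => HasDerivAt.const_mul _ ?_
  have h1 : HasDerivAt (fun τ : ℝ => (τ : ℂ) ^ q.1) (q.1 * (t : ℂ) ^ (q.1 - 1)) t :=
    (hasDerivAt_pow q.1 (t : ℂ)).comp_ofReal
  refine (h1.fun_mul (hasDerivAt_airyTerm_time hN hκ q.2 x y ht)).congr_deriv ?_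
  ring

theorem sum_heatTerm_airy (hN : 2 ≤ N) (hκ : IsHeatSign N κ) (hH : IsHadamard N κ u I U H) {x y : ℝ}
    (hxy : (x, y) ∈ U) (M : ℕ) {t : ℝ} (ht : 0 < t) :
    ∑ q ∈ range (M + 1) ×ˢ range (N - 1), heatTerm N (κ : ℂ) (fun i => u i x)
      (fun l => iteratedDeriv l (heatCoeff H y q.1 q.2) x)
      (fun j k => (t : ℂ) ^ k * airyTerm N κ j x y t) q.1 q.2 =
    deriv (fun τ => heatKernelTrunc N κ H M x y τ) t
        - κ * applyL N u (fun ξ => heatKernelTrunc N κ H M ξ y t) x := by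
  rw [(hasDerivAt_heatKernelTrunc hN hκ M x y ht).deriv, applyL]
  simp only [iteratedDeriv_heatKernelTrunc hN hκ hH hxy M _ ht]
  simp only [mul_sum]
  rw [sum_comm (s := range (N - 1)), ← sum_add_distrib, mul_sum, ← sum_sub_distrib]
  refine sum_congr rfl fun q _ => ?_
  simp only [heatTerm, smul_eq_mul, iteratedDeriv_zero, mul_sum]
  simp only [← mul_sum]
  ring

theorem map_heatTerm {E F : Type*} [AddCommGroup E] [Module ℂ E] [AddCommGroup F] [Module ℂ F]
    (f : E →ₗ[ℂ] F) (N : ℕ) (κ : ℂ) (v g : ℕ → ℂ) (e : ℕ → ℕ → E) (k j : ℕ) :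
    f (heatTerm N κ v g e k j) = heatTerm N κ v g (fun j k => f (e j k)) k j := by
  simp only [heatTerm, map_sub, map_add, map_sum, map_smul]

/-- The functions `t^k · t^{-(j+1)/N} A^{(j)}` of `t` together with the coefficients of
`(κ/N)^k ∂^j D_N^k`, at a fixed point. -/
noncomputable def heatBasis (N : ℕ) (κ x y : ℝ) (j k : ℕ) : Set.Ioi (0 : ℝ) ⊕ ℤ → ℂ :=
  Sum.elim (fun t => (t : ℂ) ^ k * airyTerm N κ j x y t) fun p => symE N κ y j k p x

theorem heatBasis_reduce (hN : 2 ≤ N) (hκ : IsHeatSign N κ) (x y : ℝ) (m k : ℕ) :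
    heatBasis N κ x y (N - 1 + m) (k + 1) =
      (-((κ : ℂ) / N) * (x - y : ℝ)) • heatBasis N κ x y m k +
        (-((κ : ℂ) / N) * m) • heatBasis N κ x y (m - 1) k := by
  have hκ2 : (κ : ℂ) ^ 2 = 1 := by exact_mod_cast isHeatSign_sq_eq_one hκ
  have hNC : (N : ℂ) ≠ 0 := by exact_mod_cast (by omega : N ≠ 0)
  funext a
  rcases a with t | p
  · have h := airyTerm_recurrence hN hκ m x y t.2
    simp only [heatBasis, Sum.elim_inl, Pi.add_apply, Pi.smul_apply, smul_eq_mul]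
    have h2 : (t : ℂ) * airyTerm N κ (N - 1 + m) x y t = -((κ : ℂ) / N) *
        ((x - y : ℝ) * airyTerm N κ m x y t + m * airyTerm N κ (m - 1) x y t) := by
      field_simp
      linear_combination κ * h - N * t * airyTerm N κ (N - 1 + m) x y t * hκ2
    rw [pow_succ]
    linear_combination (t : ℂ) ^ k * h2
  · exact symE_reduce hN y m k p x

/-- `ℒ H = H ∂^N` away from the diagonal. -/
theorem applyLSym_heatOp_of_ne (hN : 2 ≤ N) (hκ : IsHeatSign N κ) (hH : IsHadamard N κ u I U H)
    {x y : ℝ} (hxy : (x, y) ∈ U) (hne : x ≠ y) (p : ℤ) :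
    applyLSym N u (heatOp N κ H y).coeff p x = (heatOp N κ H y).coeff (p - N) x := by
  -- The first bound makes the truncation exact for all coefficients that occur, down to `∂^(p-N)`;
  -- the second ensures that `M - 1` is a true predecessor.
  obtain ⟨M, hM1, hM2⟩ : ∃ M : ℕ, (N : ℤ) - p ≤ M ∧ N ≤ M :=
    ⟨max (N - p).toNat N, by omega, by omega⟩
  have hmem : ∑ q ∈ range (M + 1) ×ˢ range (N - 1), heatTerm N (κ : ℂ) (fun i => u i x)
      (fun l => iteratedDeriv l (heatCoeff H y q.1 q.2) x) (heatBasis N κ x y) q.1 q.2 ∈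
      Submodule.span ℂ ((fun q : ℕ × ℕ => heatBasis N κ x y q.2 q.1) ''
        ↑(range (M + 1) ×ˢ range (N - 1))) := by
    refine Submodule.sum_mem _ fun q hq => ?_
    simp only [mem_product, mem_range] at hq
    refine heatTerm_mem_span hN _ _ (β := fun m => -((κ : ℂ) / N) * m)
      (heatBasis_reduce hN hκ x y) (by omega) hq.2 fun h0 l hl => ?_
    have : heatCoeff H y q.1 q.2 = fun _ => if q.2 = 0 then 1 else 0 := by
      funext ξ; simp [heatCoeff, h0]
    rw [this, iteratedDeriv_const]
    rcases hl with hl | hl <;> simp [hl]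
  -- `heatBasis` carries functions and symbols at once, so the same `c` governs both: its values are
  -- found on the functions and then used on the symbols.
  obtain ⟨c, hc⟩ := (Submodule.mem_span_image_finset_iff_exists_fun' ℂ).1 hmem
  obtain ⟨r, hr⟩ := hH.heat M x y hxy
  have hairy : ∀ t : ℝ, 0 < t → ∑ q ∈ range (M + 1) ×ˢ range (N - 1),
      c q * ((t : ℂ) ^ q.1 * airyTerm N κ q.2 x y t) =
      ∑ j ∈ range (N - 1), r j * ((t : ℂ) ^ M * airyTerm N κ j x y t) := by
    intro t ht
    rw [← hr t ht, ← sum_heatTerm_airy hN hκ hH hxy M ht]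
    have h := congrArg (LinearMap.proj (R := ℂ) (φ := fun _ : Set.Ioi (0 : ℝ) ⊕ ℤ => ℂ)
      (Sum.inl ⟨t, ht⟩)) hc
    simp only [map_sum, map_smul, map_heatTerm] at h
    exact h
  have hc0 : ∀ k < M, ∀ j < N - 1, c (k, j) = 0 := by
    intro k hk j hj
    have h := airyTerm_linearIndependent hN hκ hne M
      -- The remainder of the truncated heat equation is itself a combination of basis functions
      -- with `k = M`, so it only alters those coefficients.
      (fun k j => c (k, j) - if k = M then r j else 0) (fun t ht => ?_) k (by omega) j hj
    · simpa [hk.ne] using h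
    · have h1 := hairy t ht
      rw [sum_product] at h1
      simp only [sub_mul, sum_sub_distrib, h1]
      have h2 : ∑ k ∈ range M, ∑ j ∈ range (N - 1),
          (if k = M then r j else 0) * ((t : ℂ) ^ k * airyTerm N κ j x y t) = 0 := by
        refine sum_eq_zero fun k hk => ?_
        rw [mem_range] at hk
        simp [hk.ne]
      rw [sum_range_succ _ M, h2]
      simp
  have hsym : (κ : ℂ) * (heatSymTrunc N κ H y M (p - N) x -
      applyLSym N u (heatSymTrunc N κ H y M) p x) = 0 := by
    rw [← sum_heatTerm_symE hN hκ hH hxy]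
    have h := congrArg (LinearMap.proj (R := ℂ) (φ := fun _ : Set.Ioi (0 : ℝ) ⊕ ℤ => ℂ)
      (Sum.inr p)) hc
    simp only [map_sum, map_smul, map_heatTerm] at h
    refine h.symm.trans (sum_eq_zero fun q hq => ?_)
    simp only [mem_product, mem_range] at hq
    rcases lt_or_eq_of_le (show q.1 ≤ M by omega) with hlt | heq
    · rw [hc0 q.1 hlt q.2 hq.2, zero_smul]
    -- The surviving terms contain `D_N^M`, and `∂^j D_N^M` has order below `p`.
    · change c q * symE N κ y q.2 q.1 p x = 0
      rw [symE_order (M := M - 1) hN hq.2 (by omega) (by omega), mul_zero]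
  have hκ0 : (κ : ℂ) ≠ 0 := by
    have h1 := isHeatSign_sq_eq_one hκ
    have h2 : κ ≠ 0 := by rintro rfl; norm_num at h1
    exact_mod_cast h2
  have hfin := sub_eq_zero.1 ((mul_eq_zero.1 hsym).resolve_left hκ0)
  rw [heatOp_coeff_eq_trunc hN (M := M) (by omega), hfin, applyLSym, applyLSym]
  have hd : ∀ i ≤ N, delMul i (heatOp N κ H y).coeff p x =
      delMul i (heatSymTrunc N κ H y M) p x := fun i hi => delMul_congr fun q hq =>
    Filter.Eventually.of_forall fun ξ => heatOp_coeff_eq_trunc hN (by omega) y ξ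
  rw [hd N le_rfl]
  congr 1
  refine sum_congr rfl fun i hi => ?_
  rw [mem_range] at hi
  rw [hd i (by omega)]

theorem continuousAt_delMul {X : ℤ → ℝ → ℂ} {x : ℝ} (hX : ∀ q, ContDiffAt ℝ ∞ (X q) x) (i : ℕ)
    (p : ℤ) : ContinuousAt (delMul i X p) x := by
  unfold delMul
  refine tendsto_finsetSum _ fun l _ => ?_
  exact (continuousAt_const.mul (contDiffAt_iteratedDeriv (hX _) l).continuousAt)

/-- `ℒ H = H ∂^N`. -/
theorem applyLSym_heatOp (hN : 2 ≤ N) (hκ : IsHeatSign N κ) (hI : IsOpen I)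
    (hu : ∀ i < N - 1, ContDiffOn ℝ ∞ (u i) I) (hH : IsHadamard N κ u I U H)
    {x y : ℝ} (hxy : (x, y) ∈ U) (p : ℤ) :
    applyLSym N u (heatOp N κ H y).coeff p x = (heatOp N κ H y).coeff (p - N) x := by
  by_cases hne : x = y
  · have hx : x ∈ I := (hH.subset hxy).1
    have hsm := contDiffAt_heatOp hN hH hxy
    have h1 : ContinuousAt (applyLSym N u (heatOp N κ H y).coeff p) x := by
      refine (continuousAt_delMul hsm N p).add (tendsto_finsetSum _ fun i hi => ?_)
      rw [mem_range] at hi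
      exact ((hu i hi).contDiffAt (hI.mem_nhds hx)).continuousAt.mul (continuousAt_delMul hsm i p)
    have hV : ∀ᶠ ξ in nhds x, (ξ, y) ∈ U :=
      (by fun_prop : Continuous fun ξ : ℝ => (ξ, y)).continuousAt.eventually
        (hH.isOpen.mem_nhds hxy)
    -- Linear independence fails to apply at `x = y`, but both sides are continuous in `x` and agree
    -- on a punctured neighbourhood.
    refine ((h1.eventuallyEq_nhds_iff_eventuallyEq_nhdsNE (hsm (p - N)).continuousAt).1
      ?_).eq_of_nhds
    filter_upwards [hV.filter_mono nhdsWithin_le_nhds, self_mem_nhdsWithin] with ξ hξ hξ'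
    exact applyLSym_heatOp_of_ne hN hκ hH hξ (by rw [← hne]; exact hξ') p
  · exact applyLSym_heatOp_of_ne hN hκ hH hxy hne p

theorem delMul_heatOp_residue (hN : 2 ≤ N) (hH : IsHadamard N κ u I U H) {y : ℝ}
    (hy : (y, y) ∈ U) (a : ℕ) : delMul a (heatOp N κ H y).coeff (-1) y = 0 := by
  rw [delMul_congr (Y := heatSymTrunc N κ H y (a + 1)) fun q hq => Filter.Eventually.of_forall
    fun ξ => heatOp_coeff_eq_trunc hN (by push_cast; omega) y ξ, delMul_heatSymTrunc hH hy]
  refine sum_eq_zero fun q _ => sum_eq_zero fun s _ => ?_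
  have : symE N κ y (q.2 + s.2) q.1 (-1) y = 0 := by
    rw [symE, sub_self, Complex.ofReal_zero]
    rcases q.1 with _ | k
    · rw [symPow_zero_right, symOne, if_neg (by omega)]; simp
    · rw [symPow_residue, mul_zero]
  rw [this, mul_zero]

theorem heatOp_coeff_nonneg (hN : 2 ≤ N) {p : ℤ} (hp : 0 ≤ p) (y x : ℝ) :
    (heatOp N κ H y).coeff p x = if p = 0 then 1 else 0 := by
  rw [heatOp_coeff_eq_trunc hN (M := 0) (by simpa using hp), heatSymTrunc, sum_product,
    sum_range_one]
  refine (sum_heatCoeff_zero hN y (fun j => symE N κ y j 0 p x) x).trans ?_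
  rw [symE, symPow_zero_right, symOne]
  push_cast
  split_ifs <;> simp

end HeatOperator

/-! ### The interval of points joined to the diagonal, and the conclusion. -/

theorem isOpen_setOf_uIcc_subset {V : Set ℝ} (hV : IsOpen V) (y : ℝ) :
    IsOpen {x : ℝ | ∀ s ∈ Set.uIcc x y, s ∈ V} := by
  rw [isOpen_iff_mem_nhds]
  intro x hx
  have hxV : x ∈ V := hx x Set.left_mem_uIcc
  filter_upwards [Set.ordConnectedComponent_mem_nhds.2 (hV.mem_nhds hxV)] with z hz s hs
  rcases Set.uIcc_subset_uIcc_union_uIcc (b := x) hs with h | h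
  · rw [Set.uIcc_comm] at h; exact hz h
  · exact hx s h

theorem convex_setOf_uIcc_subset (V : Set ℝ) (y : ℝ) :
    Convex ℝ {x : ℝ | ∀ s ∈ Set.uIcc x y, s ∈ V} := by
  refine Set.OrdConnected.convex ⟨fun a ha b hb z hz s hs => ?_⟩
  rcases le_total z y with h | h
  · refine ha s ?_
    rw [Set.mem_uIcc] at *
    left
    rcases hs with hs | hs <;> constructor <;> linarith [hz.1, hs.1, hs.2]
  · refine hb s ?_
    rw [Set.mem_uIcc] at *
    right
    rcases hs with hs | hs <;> constructor <;> linarith [hz.2, hs.1, hs.2]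

end HeatResolvent

open HeatResolvent in
theorem theorem4p2 (N : ℕ) (hN : 2 ≤ N) (κ : ℝ) (hκ : IsHeatSign N κ)
    (I : Set ℝ) (hI : IsOpen I)
    (u : ℕ → ℝ → ℂ) (hu : ∀ i < N - 1, ContDiffOn ℝ ∞ (u i) I)
    (U : Set (ℝ × ℝ)) (H : ℕ → ℕ → ℝ → ℝ → ℂ) (hH : IsHadamard N κ u I U H)
    (w : ℕ → ℝ → ℝ → ℂ) (hw : IsResolventCoeff N u I w) (y : ℝ) :
    (heatOp N κ H y).EqOn (resolventOp w y) {x : ℝ | ∀ s ∈ Set.uIcc x y, (s, y) ∈ U} := by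
  obtain ⟨S, T, hS, hT, hw⟩ := hw
  intro p x hx
  set V : Set ℝ := {s | (s, y) ∈ U}
  have hV : IsOpen V := hH.isOpen.preimage (by fun_prop : Continuous fun s : ℝ => (s, y))
  -- `J` is open and convex and contains `y`, so vanishing can be propagated from the diagonal by
  -- integration.
  set J : Set ℝ := {x : ℝ | ∀ s ∈ Set.uIcc x y, s ∈ V}
  have hJV : ∀ ξ ∈ J, (ξ, y) ∈ U := fun ξ hξ => hξ ξ Set.left_mem_uIcc
  have hyU : (y, y) ∈ U := hx y Set.right_mem_uIcc
  have hyI : y ∈ I := (hH.subset hyU).1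
  have hyJ : y ∈ J := by
    intro s hs
    rw [Set.uIcc_self, Set.mem_singleton_iff] at hs
    rw [hs]; exact hyU
  have hJI : ∀ ξ ∈ J, ξ ∈ I := fun ξ hξ => (hH.subset (hJV ξ hξ)).1
  have hs1 := fun q ξ (hξ : ξ ∈ J) => contDiffAt_heatOp hN hH (hJV ξ hξ) q
  have hs2 := fun q ξ (hξ : ξ ∈ J) => contDiffAt_resolventOp hI hS hw (hJI ξ hξ) hyI q
  refine sub_eq_zero.1 (symbol_eq_zero hN (u := u) (isOpen_setOf_uIcc_subset hV y)
    (convex_setOf_uIcc_subset V y) hyJ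
    (E := fun q ξ => (heatOp N κ H y).coeff q ξ - (resolventOp w y).coeff q ξ)
    (fun q ξ hξ => (hs1 q ξ hξ).sub (hs2 q ξ hξ)) (fun q hq ξ hξ => ?_) (fun q ξ hξ => ?_)
    (fun a => ?_) p x hx)
  · rw [heatOp_coeff_nonneg hN hq]
    rcases eq_or_lt_of_le hq with h0 | h0
    · rw [← h0, resolventOp_coeff_zero hI hS hT hw (hJI ξ hξ) hyI]; simp
    · simp [resolventOp, h0.ne', not_le.2 h0]
  · rw [applyLSym_sub N u _ _ q (fun q => hs1 q ξ hξ) (fun q => hs2 q ξ hξ),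
      applyLSym_heatOp hN hκ hI hu hH (hJV ξ hξ),
      applyLSym_resolventOp hN hI hS hw (hJI ξ hξ) hyI]
  · rw [delMul_sub _ _ a (-1) (fun q => hs1 q y hyJ) (fun q => hs2 q y hyJ),
      delMul_heatOp_residue hN hH hyU, delMul_resolventOp_residue hI hS hT hw hyI, sub_zero]
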